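/- Let $Z^+=(P,Q)$ be an analytic planar vector field on an open neighbourhood $U$ of the origin which, near the origin, has the (Andreev normal) form $$P(x,y)=-y+yP_1(x,y),\qquad Q(x,y)=f(x)+y\,g(x)+y^2Q_0(x,y),$$ where $P_1,Q_0,f,g$ are analytic, $P_1(0,0)=0$, $f(x)=ax^{2n-1}+O(x^{2n})$, $g(x)=bx^{\beta}+O(x^{\beta+1})$, $n\geqslant 2$, $a>0$, and one of the following monodromy conditions holds: (i) $\beta>n-1$ or $g\equiv 0$; (ii) $\beta=n-1$ and $b^2-4an<0$. Let $\nu=b$ if $\beta=n-1$ and $\nu=0$ otherwise (so that $\nu=0$ if $g\equiv0$). Then there is $x_0>0$ such that for every $x\in(0,x_0)$ the solution of $Z^+$ in $U$ with initial point $(x,0)$ has a unique half-return to $\Sigma=\{y=0\}$ through $\{y>0\}$: there are unique $\tau^+(x)\neq0$ and $\varphi^+(x)$ such that the solution is at the point $(\varphi^+(x),0)$ at time $\tau^+(x)$ and lies in $\{y>0\}$ at all times strictly between $0$ and $\tau^+(x)$. Moreover $\varphi^+(x)<0$. The half-return map $\varphi^+$, extended by $\varphi^+(0)=0$, is analytic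 on $[0,x_0)$, and there are real numbers $\alpha_i$ $(i\geqslant1)$ and $\hat T_i$ $(i\geqslant 0)$ with $\hat T_0>0$ such that the following expansions converge: $$\varphi^+(x)=-\alpha_1x-\sum_{i\geqslant2}\alpha_ix^i\quad(0\leqslant x<x_0),\qquad \tau^+(x)=\hat T_0x^{1-n}+\sum_{i\geqslant1}\hat T_ix^{i+1-n}\quad(0<x<x_0).$$ The $\alpha_i$ are the focal coefficients, obtained recursively as follows. In the coordinates $x=r\cos\theta$, $y=r^n\sin\theta$ write $dr/d\theta=\sum_{j\geqslant1}C_j(\theta)r^j$ for $\theta\in[0,\pi]$ and small $r>0$. Then $\alpha_i=r_i(\pi)$, where the functions $r_i$ $(i\geqslant1)$ on $[0,\pi]$ solve the triangular system $$r_i'(\theta)=\sum_{j=1}^{i}C_j(\theta)\,[\rho^i]\Bigl(\sum_{k\geqslant1}r_k(\theta)\rho^k\Bigr)^{j},\qquad r_1(0)=1,\quad r_i(0)=0\ (i\geqslant2),$$ and $[\rho^i]$ denotes the coefficient of $\rho^i$. In particular, $$\alpha_1=\exp\left(\int_0^{\pi}\frac{a\sin\theta\cos^{2n-1}\theta-\sin\theta\cos\theta+\nu\sin^2\theta\cos^{n-1}\theta}{a\cos^{2n}\theta+n\sin^2\theta+\nu\cos^n\theta\sin\theta}\,d\theta\right).$$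 -/

import Mathlib

open Set Filter Topology

/-- The pair `(P, Q)` is in Andreev normal form near the origin, with leading data `n, β, a, b`:
`P = -y + y P₁`, `Q = f(x) + y g(x) + y² Q₀` with analytic `P₁, Q₀, f, g`, `P₁(0,0) = 0`,
`f(x) = a x^(2n-1) + O(x^(2n))`, `g(x) = b x^β + O(x^(β+1))`, `n ≥ 2`, `a > 0`, and the
monodromy conditions: either `β > n - 1` or `g ≡ 0`, or `β = n - 1` and `b² - 4an < 0`. -/
structure IsAndreevNormalForm (n β : ℕ) (a b : ℝ) (P Q : ℝ × ℝ → ℝ) : Prop where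
  two_le : 2 ≤ n
  a_pos : 0 < a
  exists_form : ∃ (P₁ Q₀ : ℝ × ℝ → ℝ) (f g : ℝ → ℝ),
    AnalyticAt ℝ P₁ (0, 0) ∧ AnalyticAt ℝ Q₀ (0, 0) ∧ AnalyticAt ℝ f 0 ∧ AnalyticAt ℝ g 0 ∧
    P₁ (0, 0) = 0 ∧
    (∀ᶠ p : ℝ × ℝ in 𝓝 (0, 0), P p = -p.2 + p.2 * P₁ p) ∧
    (∀ᶠ p : ℝ × ℝ in 𝓝 (0, 0), Q p = f p.1 + p.2 * g p.1 + p.2 ^ 2 * Q₀ p) ∧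
    (fun x => f x - a * x ^ (2 * n - 1)) =O[𝓝 0] (fun x : ℝ => x ^ (2 * n)) ∧
    (fun x => g x - b * x ^ β) =O[𝓝 0] (fun x : ℝ => x ^ (β + 1)) ∧
    ((n - 1 < β ∨ ∀ᶠ x in 𝓝 0, g x = 0) ∨ (β = n - 1 ∧ b ^ 2 - 4 * a * n < 0))

/-- The orbit of `(P, Q)` in `U` that starts at `(x, 0)` stays in `{y > 0}` at all times strictly
between `0` and `t ≠ 0`, and is at the point `(z, 0)` of `Σ = {y = 0}` at time `t`. That is, `z` is
the value at `x` of the half-return map of `{y ≥ 0}`, and `t` is the flight time. As usual for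
half-return maps, `t` may have either sign. -/
def IsHalfReturn (U : Set (ℝ × ℝ)) (P Q : ℝ × ℝ → ℝ) (x t z : ℝ) : Prop :=
  t ≠ 0 ∧ ∃ γ : ℝ → ℝ × ℝ,
    γ 0 = (x, 0) ∧ γ t = (z, 0) ∧
    (∀ s ∈ uIcc 0 t, γ s ∈ U ∧ HasDerivWithinAt γ (P (γ s), Q (γ s)) (uIcc 0 t) s) ∧
    ∀ s ∈ Ioo (min 0 t) (max 0 t), 0 < (γ s).2

/-- `r'` in the coordinates `x = r cos θ`, `y = r ^ n sin θ`. -/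
noncomputable def blowupR (n : ℕ) (P Q : ℝ × ℝ → ℝ) (r θ : ℝ) : ℝ :=
  (r ^ n * Real.cos θ * P (r * Real.cos θ, r ^ n * Real.sin θ)
      + r * Real.sin θ * Q (r * Real.cos θ, r ^ n * Real.sin θ))
    / (r ^ n * (Real.cos θ ^ 2 + n * Real.sin θ ^ 2))

/-- `θ'` in the coordinates `x = r cos θ`, `y = r ^ n sin θ`. -/
noncomputable def blowupTheta (n : ℕ) (P Q : ℝ × ℝ → ℝ) (r θ : ℝ) : ℝ :=
  (r * Real.cos θ * Q (r * Real.cos θ, r ^ n * Real.sin θ)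
      - n * r ^ n * Real.sin θ * P (r * Real.cos θ, r ^ n * Real.sin θ))
    / (r ^ (n + 1) * (Real.cos θ ^ 2 + n * Real.sin θ ^ 2))

/-- The numbers `α i`, `i ≥ 1`, are the focal coefficients of the half-plane `{y ≥ 0}`, given by
the usual recursion. With `dr/dθ = ∑_{j ≥ 1} C j θ * r ^ j` for `0 ≤ θ ≤ π` in the coordinates
`x = r cos θ`, `y = r ^ n sin θ`, one has `α i = R i π`, where `∑_{i ≥ 1} R i θ * ρ ^ i` is the
formal solution with value `ρ` at `θ = 0`. Comparing the coefficients of `ρ ^ i`, this is the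
triangular system `(R i)' = ∑_{j = 1}^{i} C j * [ρ ^ i] (∑_k R k * ρ ^ k) ^ j`, with
`R 1 0 = 1` and `R i 0 = 0` for `i ≠ 1`. -/
def IsFocalCoefficients (n : ℕ) (P Q : ℝ × ℝ → ℝ) (α : ℕ → ℝ) : Prop :=
  ∃ C R : ℕ → ℝ → ℝ,
    (∀ θ ∈ Icc 0 Real.pi, ∀ᶠ r in 𝓝[>] (0 : ℝ),
      HasSum (fun j : ℕ => C (j + 1) θ * r ^ (j + 1))
        (blowupR n P Q r θ / blowupTheta n P Q r θ)) ∧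
    (∀ θ, R 0 θ = 0) ∧ R 1 0 = 1 ∧ (∀ i, 2 ≤ i → R i 0 = 0) ∧
    (∀ i, 1 ≤ i → ∀ θ ∈ Icc 0 Real.pi,
      HasDerivWithinAt (R i)
        (∑ j ∈ Finset.Icc 1 i,
          C j θ * PowerSeries.coeff i ((PowerSeries.mk fun k => R k θ) ^ j))
        (Icc 0 Real.pi) θ) ∧
    ∀ i, 1 ≤ i → α i = R i Real.pi

/-! The blow-up `x = r cos θ`, `y = r ^ n sin θ` turns the field into `r' = r ^ n (cos θ p + sin θ
q) / D`, `θ' = r ^ (n - 1) B / D`, where `D = cos² θ + n sin² θ`, `B = cos θ q - n sin θ p`, and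
`p`, `q` extend analytically to `r = 0`. There `B` is a quadratic form in `(cos ^ n θ, sin θ)` of
discriminant `ν² - 4an`, which the monodromy condition makes negative; so `B > 0`
(`polar_angular_pos`), and an orbit near the origin sweeps through `0 ≤ θ ≤ π` along `dr/dθ = r H(r,
θ)`.

Analytic dependence on the initial value `x` is obtained in the Banach algebra of continuous
functions on `[0, π]`. With `r = x exp v` the equation reads `v = ∫₀^θ H(x exp v)`. Superposition
with an analytic function is analytic there (`AnalyticAt.exists_superposition`), and at `x = 0` the
right side does not depend on `v`, so the implicit function theorem gives `v` analytic in `x`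
(`exists_analyticAt_eq_exp_smul`). The half-return is `-x exp (v x π)`. Comparing powers of `x` in
`r = x + ∫ r H` yields the triangular system (`exists_radial_solution`), the series of `r H` being a
composition (`eventually_hasSum_comp`).

The flight time is `∫ D / (r ^ (n - 1) B) dθ`, that is, `x ^ (1 - n)` times an analytic function
positive at `0`. A change of time turns the radial solution into a planar orbit
(`isHalfReturn_of_polar`). Since `Q (x, 0) > 0`, every half-return runs forward in time, and
uniqueness for the planar equation makes it unique (`IsHalfReturn.unique`). -/

/-! ### Superposition operators on spaces of continuous functions. -/

/-- The superposition of a continuous multilinear map with continuous functions on a compact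
space, as a continuous multilinear map. -/
noncomputable def ContinuousMultilinearMap.superposition (X : Type*) [TopologicalSpace X]
    [CompactSpace X] {E F : Type*} [NormedAddCommGroup E] [NormedSpace ℝ E]
    [NormedAddCommGroup F] [NormedSpace ℝ F] {k : ℕ}
    (m : ContinuousMultilinearMap ℝ (fun _ : Fin k => E) F) :
    ContinuousMultilinearMap ℝ (fun _ : Fin k => C(X, E)) C(X, F) :=
  MultilinearMap.mkContinuous
    { toFun := fun v => ⟨fun θ => m fun i => v i θ, by fun_prop⟩
      map_update_add' := by
        intro _ v i a b
        ext θ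
        have h (w : C(X, E)) : (fun j => Function.update v i w j θ)
            = Function.update (fun j => v j θ) i (w θ) := by
          funext j
          by_cases hj : j = i
          · subst hj; simp
          · simp [hj]
        simp only [ContinuousMap.coe_mk, ContinuousMap.add_apply]
        rw [h, h, h, ContinuousMap.add_apply, m.map_update_add]
      map_update_smul' := by
        intro _ v i a b
        ext θ
        have h (w : C(X, E)) : (fun j => Function.update v i w j θ)
            = Function.update (fun j => v j θ) i (w θ) := by
          funext j
          by_cases hj : j = i
          · subst hj; simp
          · simp [hj]
        simp only [ContinuousMap.coe_mk, ContinuousMap.smul_apply]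
        rw [h, h, ContinuousMap.smul_apply, m.map_update_smul] }
    ‖m‖ (by
      intro v
      rw [ContinuousMap.norm_le _ (by positivity)]
      intro θ
      refine (m.le_opNorm _).trans ?_
      gcongr
      exact ContinuousMap.norm_coe_le_norm _ _)

theorem ContinuousMultilinearMap.norm_superposition_le {X : Type*} [TopologicalSpace X]
    [CompactSpace X] {E F : Type*} [NormedAddCommGroup E] [NormedSpace ℝ E]
    [NormedAddCommGroup F] [NormedSpace ℝ F] {k : ℕ}
    (m : ContinuousMultilinearMap ℝ (fun _ : Fin k => E) F) :
    ‖m.superposition X‖ ≤ ‖m‖ :=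
  MultilinearMap.mkContinuous_norm_le _ (norm_nonneg _) _

/-- The superposition operator of a map that is analytic at `0` is analytic at `0` on the space of
continuous functions on a compact space. -/
theorem AnalyticAt.exists_superposition (X : Type*) [TopologicalSpace X]
    [CompactSpace X] {E F : Type*} [NormedAddCommGroup E] [NormedSpace ℝ E]
    [NormedAddCommGroup F] [NormedSpace ℝ F] [CompleteSpace F] {f : E → F}
    (hf : AnalyticAt ℝ f 0) :
    ∃ N : C(X, E) → C(X, F), AnalyticAt ℝ N 0 ∧ ∀ᶠ v in 𝓝 0, ∀ θ, N v θ = f (v θ) := by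
  obtain ⟨p, r, hp⟩ := hf
  let q : FormalMultilinearSeries ℝ C(X, E) C(X, F) := fun k => (p k).superposition X
  have hq : p.radius ≤ q.radius := by
    refine ENNReal.le_of_forall_nnreal_lt fun s hs => ?_
    refine q.le_radius_of_summable ?_
    refine (p.summable_norm_mul_pow hs).of_nonneg_of_le (fun k => by positivity) fun k => ?_
    gcongr
    exact (p k).norm_superposition_le
  have hq0 : 0 < q.radius := (hp.r_pos.trans_le hp.r_le).trans_le hq
  -- Outside the ball of convergence `q.sum` is unrelated to `f`, so the pointwise identity holds
  -- only near `0`.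
  refine ⟨q.sum, (q.hasFPowerSeriesOnBall hq0).analyticAt, ?_⟩
  filter_upwards [Metric.eball_mem_nhds (0 : C(X, E)) hp.r_pos] with v hv θ
  have hv' : v ∈ Metric.eball (0 : C(X, E)) q.radius :=
    Metric.eball_subset_eball (hp.r_le.trans hq) hv
  have h1 := (q.hasSum hv').map (ContinuousMap.evalCLM ℝ θ : C(X, F) →L[ℝ] F)
    (ContinuousLinearMap.continuous _)
  have h2 : v θ ∈ Metric.eball (0 : E) r := by
    rw [mem_eball_zero_iff] at hv ⊢
    refine lt_of_le_of_lt ?_ hv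
    rw [enorm_le_iff_norm_le]
    exact v.norm_coe_le_norm θ
  have h3 := hp.hasSum h2
  rw [zero_add] at h3
  exact h1.unique h3

/-! ### Division of analytic functions by powers of the variable. -/

/-- An analytic function that is `O(x ^ m)` is divisible by `x ^ m`. -/
theorem AnalyticAt.exists_eq_pow_mul {h : ℝ → ℝ} (hh : AnalyticAt ℝ h 0) {m : ℕ}
    (hO : h =O[𝓝 0] fun x : ℝ => x ^ m) :
    ∃ k : ℝ → ℝ, AnalyticAt ℝ k 0 ∧ ∀ᶠ x in 𝓝 0, h x = x ^ m * k x := by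
  -- If the order were `j < m`, the cofactor `g` of `x ^ j` would be `O(x ^ (m - j))` off `0`, hence
  -- would vanish at `0`.
  have : (m : ℕ∞) ≤ analyticOrderAt h 0 := by
    by_contra hlt
    rw [not_le] at hlt
    obtain ⟨j, hj⟩ := ENat.ne_top_iff_exists.1 (ne_top_of_lt hlt)
    rw [← hj, Nat.cast_lt] at hlt
    obtain ⟨g, hg, hg0, he⟩ := (hh.analyticOrderAt_eq_natCast (n := j)).1 hj.symm
    refine hg0 ?_
    have h1 : g =O[𝓝[≠] 0] fun x : ℝ => x ^ (m - j) := by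
      obtain ⟨c, hc⟩ := hO.bound
      refine Asymptotics.IsBigO.of_bound c ?_
      filter_upwards [nhdsWithin_le_nhds hc, nhdsWithin_le_nhds he, self_mem_nhdsWithin]
        with x hx hx' hx0
      rw [hx', sub_zero, smul_eq_mul, norm_mul, show m = j + (m - j) by omega, pow_add, norm_mul,
        mul_left_comm] at hx
      have : 0 < ‖x ^ j‖ := norm_pos_iff.2 (pow_ne_zero _ hx0)
      exact le_of_mul_le_mul_left hx this
    have h2 : Tendsto (fun x : ℝ => x ^ (m - j)) (𝓝[≠] 0) (𝓝 0) := by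
      have : Tendsto (fun x : ℝ => x ^ (m - j)) (𝓝 0) (𝓝 (0 ^ (m - j))) :=
        (continuous_pow _).tendsto 0
      rw [zero_pow (by omega)] at this
      exact this.mono_left nhdsWithin_le_nhds
    exact tendsto_nhds_unique (hg.continuousAt.tendsto.mono_left nhdsWithin_le_nhds)
      (h1.trans_tendsto h2)
  obtain ⟨k, hk, he⟩ := (natCast_le_analyticOrderAt hh).1 this
  exact ⟨k, hk, by simpa using he⟩

/-- An analytic function with `h(x) = c x ^ m + O(x ^ (m + 1))` is `x ^ m` times an analytic
function with value `c` at `0`. -/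
theorem AnalyticAt.exists_eq_pow_mul_of_leading {h : ℝ → ℝ} (hh : AnalyticAt ℝ h 0) {m : ℕ}
    {c : ℝ} (hO : (fun x => h x - c * x ^ m) =O[𝓝 0] fun x : ℝ => x ^ (m + 1)) :
    ∃ k : ℝ → ℝ, AnalyticAt ℝ k 0 ∧ k 0 = c ∧ ∀ᶠ x in 𝓝 0, h x = x ^ m * k x := by
  have : AnalyticAt ℝ (fun x => h x - c * x ^ m) 0 := by fun_prop
  obtain ⟨k, hk, he⟩ := this.exists_eq_pow_mul hO
  refine ⟨fun x => c + x * k x, by fun_prop, by simp, ?_⟩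
  filter_upwards [he] with x hx
  linear_combination hx

/-! ### The Volterra operator and the implicit function theorem. -/

/-- The Volterra operator `h ↦ ∫₀^θ h` on the continuous functions on `[0, π]`. -/
noncomputable def volterra : C(Icc (0 : ℝ) Real.pi, ℝ) →L[ℝ] C(Icc (0 : ℝ) Real.pi, ℝ) :=
  LinearMap.mkContinuous
    { toFun := fun h => ⟨fun θ => ∫ s in (0 : ℝ)..θ, IccExtend Real.pi_nonneg h s, by
        have : Continuous (IccExtend Real.pi_nonneg h) := h.continuous.Icc_extend'
        have h2 : Continuous fun t : ℝ => ∫ s in (0 : ℝ)..t, IccExtend Real.pi_nonneg h s :=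
          intervalIntegral.continuous_primitive (fun a b => this.intervalIntegrable a b) 0
        exact h2.comp continuous_subtype_val⟩
      map_add' := by
        intro f g
        ext θ
        have hf : Continuous (IccExtend Real.pi_nonneg f) := f.continuous.Icc_extend'
        have hg : Continuous (IccExtend Real.pi_nonneg g) := g.continuous.Icc_extend'
        simp only [ContinuousMap.coe_mk, ContinuousMap.add_apply]
        rw [← intervalIntegral.integral_add (hf.intervalIntegrable _ _)
          (hg.intervalIntegrable _ _)]
        rfl
      map_smul' := by
        intro c f
        ext θ
        simp only [ContinuousMap.coe_mk, ContinuousMap.smul_apply, RingHom.id_apply]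
        rw [← intervalIntegral.integral_smul]
        rfl }
    Real.pi (by
      intro h
      rw [ContinuousMap.norm_le _ (by positivity)]
      intro θ
      have := intervalIntegral.norm_integral_le_of_norm_le_const (a := 0) (b := (θ : ℝ))
        (f := IccExtend Real.pi_nonneg h) (C := ‖h‖) (fun s _ => h.norm_coe_le_norm _)
      refine this.trans ?_
      rw [sub_zero, abs_of_nonneg θ.2.1, mul_comm]
      gcongr
      exact θ.2.2)

theorem volterra_apply (h : C(Icc (0 : ℝ) Real.pi, ℝ)) (θ : Icc (0 : ℝ) Real.pi) :
    volterra h θ = ∫ s in (0 : ℝ)..θ, IccExtend Real.pi_nonneg h s := rfl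

/-- The primitive of `h`, extended by constants, that vanishes at `0`. -/
theorem hasDerivAt_integral_IccExtend (h : C(Icc (0 : ℝ) Real.pi, ℝ)) (θ : ℝ) :
    HasDerivAt (fun t => ∫ s in (0 : ℝ)..t, IccExtend Real.pi_nonneg h s)
      (IccExtend Real.pi_nonneg h θ) θ := by
  have : Continuous (IccExtend Real.pi_nonneg h) := h.continuous.Icc_extend'
  exact intervalIntegral.integral_hasDerivAt_right (this.intervalIntegrable _ _)
    (this.stronglyMeasurableAtFilter _ _) this.continuousAt

/-- If `K` is a bounded linear operator on a Banach algebra and `H` is analytic at `0`, then the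
equation `v = K (H (x exp v))` has a solution `v` that depends analytically on `x` near `0`. -/
theorem exists_analyticAt_eq_exp_smul {A : Type*} [NormedRing A] [NormedAlgebra ℝ A]
    [CompleteSpace A] (K : A →L[ℝ] A) {H : A → A} (hH : AnalyticAt ℝ H 0) :
    ∃ v : ℝ → A, AnalyticAt ℝ v 0 ∧ v 0 = K (H 0) ∧
      ∀ᶠ x in 𝓝 0, v x = K (H (x • NormedSpace.exp (v x))) := by
  let f : ℝ × A → A := fun p => p.2 - K (H (p.1 • NormedSpace.exp p.2))
  have hexp (z : A) : AnalyticAt ℝ (NormedSpace.exp : A → A) z := NormedSpace.exp_analytic z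
  have hf : AnalyticAt ℝ f (0, K (H 0)) := by
    have h1 : AnalyticAt ℝ (fun p : ℝ × A => p.1 • NormedSpace.exp p.2) (0, K (H 0)) :=
      analyticAt_fst.smul ((hexp _).comp analyticAt_snd)
    have h2 : AnalyticAt ℝ (fun p : ℝ × A => H (p.1 • NormedSpace.exp p.2)) (0, K (H 0)) :=
      AnalyticAt.fun_comp (by simpa using hH) h1
    exact analyticAt_snd.sub ((K.analyticAt _).comp h2)
  -- On the slice `x = 0` the argument of `H` is `0`, so `f` is a translation in `v`.
  have hder : fderiv ℝ f (0, K (H 0)) ∘L .inr ℝ ℝ A = ContinuousLinearMap.id ℝ A := by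
    have h1 : HasFDerivAt (fun z : A => ((0 : ℝ), z)) (.inr ℝ ℝ A) (K (H 0)) :=
      hasFDerivAt_prodMk_right _ _
    have h2 := hf.differentiableAt.hasFDerivAt.comp (K (H 0)) h1
    have h3 : f ∘ (fun z : A => ((0 : ℝ), z)) = fun z => z - K (H 0) := by
      funext z; simp [f]
    rw [h3] at h2
    exact h2.unique ((hasFDerivAt_id _).sub_const _)
  have hinv : (fderiv ℝ f (0, K (H 0)) ∘L .inr ℝ ℝ A).IsInvertible := by
    rw [hder]; exact ⟨ContinuousLinearEquiv.refl ℝ A, rfl⟩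
  -- In `WithTop ℕ∞` the element `⊤` is the analytic class, not `C^∞`, so the implicit function
  -- comes out analytic.
  have hc : ContDiffAt ℝ ⊤ f (0, K (H 0)) := hf.contDiffAt
  have htop : (⊤ : WithTop ℕ∞) ≠ 0 := by simp
  refine ⟨hc.implicitFunction htop hinv, ?_, hc.implicitFunction_apply_self htop hinv, ?_⟩
  · exact (hc.contDiffAt_implicitFunction htop hinv).analyticAt
  · filter_upwards [hc.eventually_apply_implicitFunction htop hinv] with x hx
    simp only [f, zero_smul, sub_self] at hx
    exact sub_eq_zero.1 hx

/-! ### Power series: uniqueness, powers and composition. -/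

/-- A function of a real variable that is analytic at `0` is the sum of a power series. -/
theorem AnalyticAt.exists_hasSum_pow_smul {E : Type*} [NormedAddCommGroup E] [NormedSpace ℝ E]
    {f : ℝ → E} (hf : AnalyticAt ℝ f 0) :
    ∃ c : ℕ → E, ∀ᶠ x in 𝓝 0, HasSum (fun i => x ^ i • c i) (f x) := by
  obtain ⟨p, hp⟩ := hf
  exact ⟨p.coeff, by simpa using hasFPowerSeriesAt_iff.1 hp⟩

/-- The coefficients of a power series are determined by its sum near `0`. -/
theorem eq_of_eventually_hasSum_pow_smul {E : Type*} [NormedAddCommGroup E] [NormedSpace ℝ E]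
    {f : ℝ → E} {c d : ℕ → E} (hc : ∀ᶠ x : ℝ in 𝓝 0, HasSum (fun i => x ^ i • c i) (f x))
    (hd : ∀ᶠ x : ℝ in 𝓝 0, HasSum (fun i => x ^ i • d i) (f x)) : c = d := by
  have key (e : ℕ → E) (he : ∀ᶠ x : ℝ in 𝓝 0, HasSum (fun i => x ^ i • e i) (f x)) :
      HasFPowerSeriesAt f
        ((fun i => ContinuousMultilinearMap.mkPiRing ℝ (Fin i) (e i) :) :
          FormalMultilinearSeries ℝ ℝ E) 0 := by
    refine hasFPowerSeriesAt_iff.2 ?_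
    simpa [FormalMultilinearSeries.coeff] using he
  have := (key c hc).eq_formalMultilinearSeries (key d hd)
  funext i
  have h2 := congrArg (fun p : FormalMultilinearSeries ℝ ℝ E => p.coeff i) this
  simpa [FormalMultilinearSeries.coeff] using h2

/-- Absolutely convergent power series may be raised to powers. -/
theorem hasSum_coeff_mk_pow {R : ℕ → ℝ} {x : ℝ} (hR : Summable fun k => ‖R k * x ^ k‖) (j : ℕ) :
    (Summable fun i => ‖PowerSeries.coeff i (PowerSeries.mk R ^ j) * x ^ i‖) ∧
      ∑' i, PowerSeries.coeff i (PowerSeries.mk R ^ j) * x ^ i = (∑' k, R k * x ^ k) ^ j := by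
  induction j with
  | zero =>
    have : ∀ i, i ≠ 0 → PowerSeries.coeff i (PowerSeries.mk R ^ 0) * x ^ i = 0 := by
      intro i hi
      simp [PowerSeries.coeff_one, hi]
    refine ⟨summable_of_ne_finset_zero (s := {0}) fun i hi => ?_, ?_⟩
    · rw [this i (by simpa using hi), norm_zero]
    · rw [tsum_eq_single 0 this]; simp
  | succ j ih =>
    have he : ∀ i, PowerSeries.coeff i (PowerSeries.mk R ^ (j + 1)) * x ^ i
        = ∑ kl ∈ Finset.HasAntidiagonal.antidiagonal i,
          (PowerSeries.coeff kl.1 (PowerSeries.mk R ^ j) * x ^ kl.1) * (R kl.2 * x ^ kl.2) := by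
      intro i
      rw [pow_succ, PowerSeries.coeff_mul, Finset.sum_mul]
      refine Finset.sum_congr rfl fun kl hkl => ?_
      rw [PowerSeries.coeff_mk, ← Finset.HasAntidiagonal.mem_antidiagonal.1 hkl, pow_add]
      ring
    have h1 := summable_norm_sum_mul_antidiagonal_of_summable_norm ih.1 hR
    have h2 := tsum_mul_tsum_eq_tsum_sum_antidiagonal_of_summable_norm ih.1 hR
    exact ⟨h1.congr fun i => by rw [he], by rw [tsum_congr he, ← h2, ih.2, pow_succ]⟩

/-- Powers of a power series without constant term. -/
theorem PowerSeries.coeff_mk_pow_eq_zero {R : ℕ → ℝ} (h0 : R 0 = 0) {i j : ℕ} (hij : i < j) :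
    PowerSeries.coeff i (PowerSeries.mk R ^ j) = 0 := by
  refine PowerSeries.coeff_of_lt_order _ ?_
  have h1 : 1 ≤ (PowerSeries.mk R).order :=
    PowerSeries.le_order _ _ fun i hi => by
      have : i = 0 := by
        have : i < 1 := by exact_mod_cast hi
        omega
      subst this; simpa using h0
  calc (i : ℕ∞) < j := by exact_mod_cast hij
    _ = j • (1 : ℕ∞) := by simp
    _ ≤ j • (PowerSeries.mk R).order := by gcongr
    _ ≤ _ := PowerSeries.le_order_pow _ _

/-- This provides the nonnegative majorant that makes the double series of a composition absolutely
summable. -/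
theorem norm_coeff_mk_pow_le (R : ℕ → ℝ) (i j : ℕ) :
    ‖PowerSeries.coeff i (PowerSeries.mk R ^ j)‖
      ≤ PowerSeries.coeff i (PowerSeries.mk (fun k => ‖R k‖) ^ j) := by
  induction j generalizing i with
  | zero => rw [pow_zero, pow_zero, PowerSeries.coeff_one]; split_ifs <;> simp
  | succ j ih =>
    rw [pow_succ, pow_succ, PowerSeries.coeff_mul, PowerSeries.coeff_mul]
    refine (norm_sum_le _ _).trans (Finset.sum_le_sum fun kl _ => ?_)
    rw [norm_mul, PowerSeries.coeff_mk, PowerSeries.coeff_mk]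
    gcongr
    exact ih _

/-- The composition of two power series, the inner one without constant term. -/
theorem hasSum_comp_of_summable {C R : ℕ → ℝ} (h0 : R 0 = 0) {x : ℝ}
    (hR : Summable fun k => ‖R k * x ^ k‖)
    (hC : Summable fun j => ‖C j‖ * (∑' k, ‖R k * x ^ k‖) ^ j) :
    HasSum (fun i => x ^ i •
        ∑ j ∈ Finset.range (i + 1), C j * PowerSeries.coeff i (PowerSeries.mk R ^ j))
      (∑' j, C j * (∑' k, R k * x ^ k) ^ j) := by
  have hR' : Summable fun k => ‖‖R k‖ * ‖x‖ ^ k‖ := by simpa using hR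
  obtain ⟨F, hFdef⟩ : ∃ F : ℕ × ℕ → ℝ, ∀ j i, F (j, i) =
      C j * (PowerSeries.coeff i (PowerSeries.mk R ^ j) * x ^ i) :=
    ⟨fun p => C p.1 * (PowerSeries.coeff p.2 (PowerSeries.mk R ^ p.1) * x ^ p.2), fun _ _ => rfl⟩
  have hF : Summable F := by
    obtain ⟨G, hG⟩ : ∃ G : ℕ × ℕ → ℝ, ∀ j i, G (j, i) = ‖C j‖ *
        (PowerSeries.coeff i (PowerSeries.mk (fun k => ‖R k‖) ^ j) * ‖x‖ ^ i) :=
      ⟨fun p => ‖C p.1‖ * (PowerSeries.coeff p.2 (PowerSeries.mk (fun k => ‖R k‖) ^ p.1) *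
        ‖x‖ ^ p.2), fun _ _ => rfl⟩
    have hnn (i j : ℕ) : 0 ≤ PowerSeries.coeff i (PowerSeries.mk (fun k => ‖R k‖) ^ j) :=
      (norm_nonneg _).trans (norm_coeff_mk_pow_le R i j)
    have hGnn : 0 ≤ G := by
      rintro ⟨j, i⟩
      rw [hG]
      have := hnn i j
      simp only [Pi.zero_apply]
      positivity
    -- For fixed `j` the majorant sums over `i` to `‖C j‖ * (∑ ‖R k x ^ k‖) ^ j`, which is summable
    -- in `j` by `hC`.
    have hGs : Summable G := by
      refine (summable_prod_of_nonneg hGnn).2 ⟨fun j => ?_, ?_⟩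
      · simp_rw [hG]
        exact ((hasSum_coeff_mk_pow hR' j).1.of_norm).mul_left _
      · simp_rw [hG, tsum_mul_left, (hasSum_coeff_mk_pow hR' _).2]
        simpa using hC
    refine hGs.of_norm_bounded fun p => ?_
    obtain ⟨j, i⟩ := p
    rw [hFdef, hG, norm_mul, norm_mul, norm_pow]
    gcongr
    exact norm_coeff_mk_pow_le R _ _
  have h1 : HasSum F (∑' j, C j * (∑' k, R k * x ^ k) ^ j) := by
    have := hF.hasSum
    rwa [hF.tsum_prod, tsum_congr fun j => ?_] at this
    simp_rw [hFdef]
    rw [tsum_mul_left, (hasSum_coeff_mk_pow hR j).2]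
  have h2 : HasSum (fun p : ℕ × ℕ => F (p.2, p.1)) (∑' j, C j * (∑' k, R k * x ^ k) ^ j) :=
    (Equiv.prodComm ℕ ℕ).hasSum_iff.2 h1
  -- Now the sum over `j` is taken for fixed `i`; it is finite because `R 0 = 0`.
  refine h2.prod_fiberwise fun i => ?_
  rw [smul_eq_mul, Finset.mul_sum]
  have : ∀ j ∉ Finset.range (i + 1), F (j, i) = 0 := by
    intro j hj
    rw [hFdef, PowerSeries.coeff_mk_pow_eq_zero h0 (by simpa using hj)]
    ring
  have h3 : HasSum (fun j => F (j, i)) (∑ j ∈ Finset.range (i + 1), F (j, i)) :=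
    hasSum_sum_of_ne_finset_zero this
  rwa [Finset.sum_congr rfl fun j _ => ?_] at h3
  rw [hFdef]
  ring

/-- A power series that converges near `0` converges absolutely near `0`, and the sum of the
absolute values tends to the absolute value of the constant coefficient. -/
theorem tendsto_tsum_norm_pow {R : ℕ → ℝ} {f : ℝ → ℝ} (h0 : R 0 = 0)
    (h : ∀ᶠ x in 𝓝 0, HasSum (fun i => x ^ i • R i) (f x)) :
    (∀ᶠ x : ℝ in 𝓝 0, Summable fun i => ‖R i * x ^ i‖) ∧
      Tendsto (fun x : ℝ => ∑' i, ‖R i * x ^ i‖) (𝓝 0) (𝓝 0) := by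
  obtain ⟨δ, hδ, hs⟩ : ∃ δ : ℝ, 0 < δ ∧ Summable fun i => ‖R i‖ * δ ^ i := by
    obtain ⟨ε, hε, hball⟩ := Metric.eventually_nhds_iff.1 h
    have h1 : Summable fun i => (ε / 2) ^ i • R i := (hball (y := ε / 2) (by
      rw [Real.dist_0_eq_abs, abs_of_pos (by positivity)]; linarith)).summable
    -- The terms at `ε / 2` are bounded, so halving the argument gives a geometric majorant of ratio
    -- `1 / 2`.
    refine ⟨ε / 4, by positivity, ?_⟩
    obtain ⟨B, hB⟩ := h1.tendsto_atTop_zero.norm.bddAbove_range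
    refine ((summable_geometric_of_lt_one (r := (1 / 2 : ℝ)) (by norm_num)
      (by norm_num)).mul_left B).of_nonneg_of_le (fun i => by positivity) fun i => ?_
    have := hB ⟨i, rfl⟩
    simp only [norm_smul, norm_pow, Real.norm_of_nonneg (by positivity : 0 ≤ ε / 2)] at this
    calc ‖R i‖ * (ε / 4) ^ i = ((ε / 2) ^ i * ‖R i‖) * (1 / 2) ^ i := by
          rw [show ε / 4 = (ε / 2) * (1 / 2) by ring, mul_pow]; ring
      _ ≤ B * (1 / 2) ^ i := by gcongr
  -- The term `i = 0` vanishes, and from every other one a factor `|x| / δ` splits off; this factor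
  -- forces the limit `0`.
  have hle {x : ℝ} (hx : |x| ≤ δ) (i : ℕ) : ‖R i * x ^ i‖ ≤ (|x| / δ) * (‖R i‖ * δ ^ i) := by
    rcases i with _ | i
    · simp [h0]
    · rw [norm_mul, norm_pow, Real.norm_eq_abs x]
      calc ‖R (i + 1)‖ * |x| ^ (i + 1) = ‖R (i + 1)‖ * (|x| * |x| ^ i) := by ring
        _ ≤ ‖R (i + 1)‖ * (|x| * δ ^ i) := by gcongr
        _ = _ := by rw [pow_succ]; field_simp
  have hev : ∀ᶠ x : ℝ in 𝓝 0, |x| ≤ δ := by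
    filter_upwards [Metric.closedBall_mem_nhds (0 : ℝ) hδ] with x hx
    simpa using hx
  have hsum {x : ℝ} (hx : |x| ≤ δ) : Summable fun i => ‖R i * x ^ i‖ :=
    (hs.mul_left (|x| / δ)).of_nonneg_of_le (fun i => norm_nonneg _) (hle hx)
  refine ⟨hev.mono fun x hx => hsum hx, ?_⟩
  have hlim : Tendsto (fun x : ℝ => (|x| / δ) * ∑' i, ‖R i‖ * δ ^ i) (𝓝 0) (𝓝 0) := by
    have : Continuous fun x : ℝ => (|x| / δ) * ∑' i, ‖R i‖ * δ ^ i := by fun_prop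
    simpa using this.tendsto 0
  refine tendsto_of_tendsto_of_tendsto_of_le_of_le' tendsto_const_nhds hlim
    (Eventually.of_forall fun x => tsum_nonneg fun i => norm_nonneg _) ?_
  filter_upwards [hev] with x hx
  rw [← tsum_mul_left]
  exact (hsum hx).tsum_le_tsum (hle hx) (hs.mul_left _)

/-- The power series of a composition, the inner function vanishing at `0`. -/
theorem eventually_hasSum_comp {C R : ℕ → ℝ} {f u : ℝ → ℝ} (hC0 : C 0 = 0) (hR0 : R 0 = 0)
    (hC : ∀ᶠ r in 𝓝 0, HasSum (fun j => r ^ j • C j) (f r))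
    (hR : ∀ᶠ x in 𝓝 0, HasSum (fun i => x ^ i • R i) (u x)) :
    ∀ᶠ x in 𝓝 0, HasSum (fun i => x ^ i •
        ∑ j ∈ Finset.range (i + 1), C j * PowerSeries.coeff i (PowerSeries.mk R ^ j))
      (f (u x)) := by
  obtain ⟨hs, ht⟩ := tendsto_tsum_norm_pow hR0 hR
  have hu : Tendsto u (𝓝 0) (𝓝 0) := by
    refine squeeze_zero_norm' ?_ ht
    filter_upwards [hs, hR] with x hx hx'
    rw [← hx'.tsum_eq]
    simpa [mul_comm] using norm_tsum_le_tsum_norm (f := fun i => R i * x ^ i) hx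
  filter_upwards [hs, hR, hu.eventually hC, ht.eventually (tendsto_tsum_norm_pow hC0 hC).1]
    with x hx hx' hx'' hx'''
  have h1 : Summable fun j => ‖C j‖ * (∑' k, ‖R k * x ^ k‖) ^ j := by
    refine hx'''.congr fun j => ?_
    rw [norm_mul, norm_pow, Real.norm_of_nonneg (tsum_nonneg fun i => norm_nonneg _)]
  have h2 := hasSum_comp_of_summable hR0 hx h1
  have h3 : ∑' k, R k * x ^ k = u x := by
    rw [← hx'.tsum_eq]; simp [mul_comm]
  have h4 : ∑' j, C j * (u x) ^ j = f (u x) := by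
    rw [← hx''.tsum_eq]; simp [mul_comm]
  rwa [h3, h4] at h2

/-! ### The Andreev normal form in blown-up polar coordinates. -/

/-- Positivity of the angular speed on the blown-up origin. -/
theorem polar_angular_pos {n : ℕ} {a ν : ℝ} (ha : 0 < a) (hν : ν ^ 2 < 4 * a * n)
    (θ : ℝ) :
    0 < a * Real.cos θ ^ (2 * n) + n * Real.sin θ ^ 2 + ν * Real.cos θ ^ n * Real.sin θ := by
  -- Completing the square in `cos ^ n θ`.
  have h1 : 4 * a * (a * Real.cos θ ^ (2 * n) + n * Real.sin θ ^ 2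
      + ν * Real.cos θ ^ n * Real.sin θ)
      = (2 * a * Real.cos θ ^ n + ν * Real.sin θ) ^ 2
        + (4 * a * n - ν ^ 2) * Real.sin θ ^ 2 := by
    rw [mul_comm 2 n, pow_mul]; ring
  have h2 : 0 < (2 * a * Real.cos θ ^ n + ν * Real.sin θ) ^ 2
        + (4 * a * n - ν ^ 2) * Real.sin θ ^ 2 := by
    have h3 : 0 < 4 * a * n - ν ^ 2 := by linarith
    by_cases hs : Real.sin θ = 0
    · have hc : Real.cos θ ≠ 0 := fun hc => by
        have := Real.sin_sq_add_cos_sq θ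
        rw [hs, hc] at this; norm_num at this
      rw [hs]
      have : 0 < (2 * a * Real.cos θ ^ n) ^ 2 := by positivity
      linarith
    · positivity
  rw [← h1] at h2
  exact pos_of_mul_pos_right h2 (by positivity)

/-- The points `(r cos θ, r ^ n sin θ)` tend to the origin as `r → 0`, uniformly in `θ`. -/
theorem eventually_forall_polar {n : ℕ} (hn : n ≠ 0) {Φ : ℝ × ℝ → Prop}
    (hΦ : ∀ᶠ z in 𝓝 (0, 0), Φ z) :
    ∀ᶠ r in 𝓝 (0 : ℝ), ∀ θ, Φ (r * Real.cos θ, r ^ n * Real.sin θ) := by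
  obtain ⟨ε, hε, hball⟩ := Metric.eventually_nhds_iff.1 hΦ
  have hn0 : Tendsto (fun r : ℝ => |r| ^ n) (𝓝 0) (𝓝 0) := by
    have : Continuous fun r : ℝ => |r| ^ n := by fun_prop
    simpa [zero_pow hn] using this.tendsto 0
  have hr0 : Tendsto (fun r : ℝ => |r|) (𝓝 0) (𝓝 0) := by
    simpa using (continuous_abs (G := ℝ)).tendsto 0
  filter_upwards [hn0.eventually_lt_const hε, hr0.eventually_lt_const hε] with r h1 h2 θ
  have hcos : |r * Real.cos θ| ≤ |r| := by
    rw [abs_mul]; exact mul_le_of_le_one_right (abs_nonneg _) (Real.abs_cos_le_one θ)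
  have hsin : |r ^ n * Real.sin θ| ≤ |r| ^ n := by
    rw [abs_mul, abs_pow]
    exact mul_le_of_le_one_right (by positivity) (Real.abs_sin_le_one θ)
  refine hball ?_
  rw [Prod.dist_eq, max_lt_iff]
  simp only [Real.dist_0_eq_abs]
  exact ⟨hcos.trans_lt h2, hsin.trans_lt h1⟩

/-- In Andreev normal form, `g(x) = ν x ^ (n - 1) + O(x ^ n)` with `ν² < 4 a n`. -/
theorem exists_leading_coefficient {n β : ℕ} {a b ν : ℝ} {g : ℝ → ℝ} (hn : 2 ≤ n) (ha : 0 < a)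
    (hν : ν = if β = n - 1 then b else 0)
    (hg : (fun x => g x - b * x ^ β) =O[𝓝 0] (fun x : ℝ => x ^ (β + 1)))
    (hm : (n - 1 < β ∨ ∀ᶠ x in 𝓝 0, g x = 0) ∨ (β = n - 1 ∧ b ^ 2 - 4 * a * n < 0)) :
    (fun x => g x - ν * x ^ (n - 1)) =O[𝓝 0] (fun x : ℝ => x ^ (n - 1 + 1)) ∧
      ν ^ 2 < 4 * a * n := by
  have hpos : (0 : ℝ) < 4 * a * n := by positivity
  have hpow {i j : ℕ} (hij : i ≤ j) : (fun x : ℝ => x ^ j) =O[𝓝 0] fun x : ℝ => x ^ i := by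
    refine Asymptotics.IsBigO.of_bound 1 ?_
    filter_upwards [Metric.closedBall_mem_nhds (0 : ℝ) one_pos] with x hx
    rw [norm_pow, norm_pow, one_mul]
    exact pow_le_pow_of_le_one (norm_nonneg _) (by simpa using hx) hij
  by_cases hβ : β = n - 1
  · rw [if_pos hβ] at hν
    subst hν hβ
    refine ⟨hg, ?_⟩
    rcases hm with (h | h) | ⟨-, h⟩
    · omega
    -- Here `g` vanishes near `0` while `β = n - 1`: the zero function has leading coefficient `ν`,
    -- so `ν = 0`.
    · have h1 : (fun x : ℝ => (-ν) * x ^ (n - 1)) =O[𝓝 0] (fun x : ℝ => x ^ (n - 1 + 1)) := by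
        refine hg.congr' ?_ EventuallyEq.rfl
        filter_upwards [h] with x hx
        rw [hx]; ring
      have h0 : AnalyticAt ℝ (fun _ : ℝ => (0 : ℝ)) 0 := analyticAt_const
      obtain ⟨k, hk, hk0, he⟩ := h0.exists_eq_pow_mul_of_leading (m := n - 1) (c := ν)
        (by simpa using h1)
      have h2 : ∀ᶠ x in 𝓝[≠] (0 : ℝ), k x = 0 := by
        filter_upwards [nhdsWithin_le_nhds he, self_mem_nhdsWithin] with x hx hx0
        exact (mul_eq_zero.1 hx.symm).resolve_left (pow_ne_zero _ hx0)
      have h3 : k 0 = 0 := tendsto_nhds_unique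
        (hk.continuousAt.tendsto.mono_left nhdsWithin_le_nhds)
        (tendsto_const_nhds.congr' (h2.mono fun x hx => hx.symm))
      rw [← hk0, h3]; simpa using hpos
    · linarith
  · rw [if_neg hβ] at hν
    subst hν
    refine ⟨?_, by simpa using hpos⟩
    simp only [zero_mul, sub_zero]
    rcases hm with (h | h) | ⟨h, -⟩
    · have h1 : (fun x : ℝ => b * x ^ β) =O[𝓝 0] fun x : ℝ => x ^ (n - 1 + 1) :=
        (hpow (by omega)).const_mul_left b
      simpa using (hg.trans (hpow (by omega))).add h1
    · exact (Asymptotics.isBigO_zero _ _).congr' (h.mono fun x hx => hx.symm) EventuallyEq.rfl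
    · exact absurd h hβ

/-- A vector field in Andreev normal form in the coordinates `x = r cos θ`, `y = r ^ n sin θ`:
`P = r ^ n p` and `Q = r ^ (2 n - 1) q`, where `p`, `q` and the ratio `H` of the polar components
`cos θ p + sin θ q` and `B = cos θ q - n sin θ p` define analytic superposition operators. -/
theorem IsAndreevNormalForm.exists_polar {n β : ℕ} {a b ν : ℝ} {P Q : ℝ × ℝ → ℝ}
    (hZ : IsAndreevNormalForm n β a b P Q) (hν : ν = if β = n - 1 then b else 0) :
    ∃ (p q : ℝ → ℝ → ℝ)
      (H B : C(Icc (0 : ℝ) Real.pi, ℝ) → C(Icc (0 : ℝ) Real.pi, ℝ)),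
      AnalyticAt ℝ H 0 ∧ AnalyticAt ℝ B 0 ∧
      (∀ᶠ r in 𝓝 (0 : ℝ), ∀ θ,
        P (r * Real.cos θ, r ^ n * Real.sin θ) = r ^ n * p r θ ∧
        Q (r * Real.cos θ, r ^ n * Real.sin θ) = r ^ (2 * n - 1) * q r θ) ∧
      (∀ θ, p 0 θ = -Real.sin θ ∧ q 0 θ = a * Real.cos θ ^ (2 * n - 1)
        + ν * Real.sin θ * Real.cos θ ^ (n - 1)) ∧
      ∀ᶠ u in 𝓝 (0 : C(Icc (0 : ℝ) Real.pi, ℝ)), ∀ θ,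
        B u θ = Real.cos θ * q (u θ) θ - n * Real.sin θ * p (u θ) θ ∧ 0 < B u θ ∧
        H u θ * B u θ = Real.cos θ * p (u θ) θ + Real.sin θ * q (u θ) θ := by
  obtain ⟨hn, ha, P₁, Q₀, f, g, hP₁, hQ₀, hf, hg, hP₁0, hP, hQ, hfO, hgO, hm⟩ := hZ
  obtain ⟨hgO', hdisc⟩ := exists_leading_coefficient hn ha hν hgO hm
  obtain ⟨F, hF, hF0, hfF⟩ := hf.exists_eq_pow_mul_of_leading (m := 2 * n - 1) (c := a)
    (by rwa [show 2 * n - 1 + 1 = 2 * n by omega])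
  obtain ⟨G, hG, hG0, hgG⟩ := hg.exists_eq_pow_mul_of_leading hgO'
  let p : ℝ → ℝ → ℝ := fun r θ =>
    Real.sin θ * (-1 + P₁ (r * Real.cos θ, r ^ n * Real.sin θ))
  -- The terms `f`, `y g` and `y² Q₀` carry `r ^ (2n - 1)`, `r ^ n * r ^ (n - 1)` and `r ^ (2n)`;
  -- hence the extra `r` in the last summand.
  let q : ℝ → ℝ → ℝ := fun r θ =>
    Real.cos θ ^ (2 * n - 1) * F (r * Real.cos θ)
      + Real.sin θ * Real.cos θ ^ (n - 1) * G (r * Real.cos θ)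
      + r * Real.sin θ ^ 2 * Q₀ (r * Real.cos θ, r ^ n * Real.sin θ)
  have hp0 : ∀ θ, p 0 θ = -Real.sin θ := fun θ => by
    simp only [p, zero_mul, zero_pow (by omega : n ≠ 0), hP₁0]; ring
  have hq0 : ∀ θ, q 0 θ = a * Real.cos θ ^ (2 * n - 1)
        + ν * Real.sin θ * Real.cos θ ^ (n - 1) := fun θ => by
    simp only [q, zero_mul, hF0, hG0]; ring
  have hb0 : ∀ θ, 0 < Real.cos θ * q 0 θ - n * Real.sin θ * p 0 θ := fun θ => by
    have := polar_angular_pos ha hdisc θ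
    rw [hp0, hq0]
    obtain ⟨m, rfl⟩ : ∃ m, n = m + 1 := ⟨n - 1, by omega⟩
    rw [show 2 * (m + 1) = 2 * m + 1 + 1 by ring] at this
    simp only [show 2 * (m + 1) - 1 = 2 * m + 1 by omega, Nat.add_sub_cancel]
    refine this.trans_eq ?_
    ring
  obtain ⟨NP, hNP, hNP'⟩ := hP₁.exists_superposition (Icc (0 : ℝ) Real.pi)
  obtain ⟨NQ, hNQ, hNQ'⟩ := hQ₀.exists_superposition (Icc (0 : ℝ) Real.pi)
  obtain ⟨NF, hNF, hNF'⟩ := hF.exists_superposition (Icc (0 : ℝ) Real.pi)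
  obtain ⟨NG, hNG, hNG'⟩ := hG.exists_superposition (Icc (0 : ℝ) Real.pi)
  let c : C(Icc (0 : ℝ) Real.pi, ℝ) := ⟨fun θ => Real.cos θ, by fun_prop⟩
  let s : C(Icc (0 : ℝ) Real.pi, ℝ) := ⟨fun θ => Real.sin θ, by fun_prop⟩
  let X : C(Icc (0 : ℝ) Real.pi, ℝ) → C(Icc (0 : ℝ) Real.pi, ℝ) := fun u => u * c
  -- Assembling the pair through the two linear inclusions makes its analyticity immediate.
  let Y : C(Icc (0 : ℝ) Real.pi, ℝ) → C(Icc (0 : ℝ) Real.pi, ℝ × ℝ) := fun u =>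
    (ContinuousLinearMap.inl ℝ ℝ ℝ).compLeftContinuous ℝ (Icc (0 : ℝ) Real.pi) (u * c) +
    (ContinuousLinearMap.inr ℝ ℝ ℝ).compLeftContinuous ℝ (Icc (0 : ℝ) Real.pi) (u ^ n * s)
  have hXa : AnalyticAt ℝ X 0 := analyticAt_id.mul analyticAt_const
  have hYa : AnalyticAt ℝ Y 0 :=
    ((ContinuousLinearMap.analyticAt _ _).comp (analyticAt_id.mul analyticAt_const)).add
      ((ContinuousLinearMap.analyticAt _ _).comp ((analyticAt_id.pow n).mul analyticAt_const))
  have hX0 : X 0 = 0 := zero_mul _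
  have hY : ∀ u θ, Y u θ = (u θ * Real.cos θ, u θ ^ n * Real.sin θ) := by
    intro u θ
    simp [Y, c, s]
  have hY0 : Y 0 = 0 := by
    ext θ <;> simp [hY, zero_pow (by omega : n ≠ 0)]
  have hXt : Tendsto X (𝓝 0) (𝓝 0) := by simpa [hX0] using hXa.continuousAt.tendsto
  have hYt : Tendsto Y (𝓝 0) (𝓝 0) := by simpa [hY0] using hYa.continuousAt.tendsto
  let p' : C(Icc (0 : ℝ) Real.pi, ℝ) → C(Icc (0 : ℝ) Real.pi, ℝ) := fun u =>
    s * (-1 + NP (Y u))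
  let q' : C(Icc (0 : ℝ) Real.pi, ℝ) → C(Icc (0 : ℝ) Real.pi, ℝ) := fun u =>
    c ^ (2 * n - 1) * NF (X u) + s * c ^ (n - 1) * NG (X u) + u * s ^ 2 * NQ (Y u)
  have hp'a : AnalyticAt ℝ p' 0 := by
    have h1 : AnalyticAt ℝ (fun u => NP (Y u)) 0 := AnalyticAt.fun_comp (by rwa [hY0]) hYa
    exact analyticAt_const.mul (analyticAt_const.add h1)
  have hq'a : AnalyticAt ℝ q' 0 := by
    have h1 : AnalyticAt ℝ (fun u => NQ (Y u)) 0 := AnalyticAt.fun_comp (by rwa [hY0]) hYa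
    have h2 : AnalyticAt ℝ (fun u => NF (X u)) 0 := AnalyticAt.fun_comp (by rwa [hX0]) hXa
    have h3 : AnalyticAt ℝ (fun u => NG (X u)) 0 := AnalyticAt.fun_comp (by rwa [hX0]) hXa
    exact ((analyticAt_const.mul h2).add (analyticAt_const.mul h3)).add
      ((analyticAt_id.mul analyticAt_const).mul h1)
  have hpq : ∀ᶠ u in 𝓝 (0 : C(Icc (0 : ℝ) Real.pi, ℝ)), ∀ θ,
      p' u θ = p (u θ) θ ∧ q' u θ = q (u θ) θ := by
    filter_upwards [hYt.eventually hNP', hYt.eventually hNQ', hXt.eventually hNF',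
      hXt.eventually hNG'] with u h1 h2 h3 h4 θ
    constructor
    · simp [p', p, h1, hY, s]
    · simp [q', q, h2, h3, h4, hY, s, c, X]
  let B : C(Icc (0 : ℝ) Real.pi, ℝ) → C(Icc (0 : ℝ) Real.pi, ℝ) := fun u =>
    c * q' u - (n : ℝ) • (s * p' u)
  have hBa : AnalyticAt ℝ B 0 := by
    have h1 : AnalyticAt ℝ (fun u => s * p' u) 0 := analyticAt_const.mul hp'a
    exact (analyticAt_const.mul hq'a).sub h1.fun_const_smul
  have hB : ∀ u θ, B u θ = Real.cos θ * q' u θ - n * Real.sin θ * p' u θ := by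
    intro u θ
    simp [B, c, s, mul_assoc]
  have hB0 : ∀ θ, 0 < B 0 θ := fun θ => by
    rw [hB, (hpq.self_of_nhds θ).1, (hpq.self_of_nhds θ).2]
    exact hb0 θ
  -- By compactness `B 0` has a positive minimum, and a sup-norm perturbation smaller than it keeps
  -- `B u` positive.
  have hBpos : ∀ᶠ u in 𝓝 (0 : C(Icc (0 : ℝ) Real.pi, ℝ)), ∀ θ, 0 < B u θ := by
    obtain ⟨θ₀, -, hθ₀⟩ := isCompact_univ.exists_isMinOn
      (⟨⟨0, by simp [Real.pi_nonneg]⟩, mem_univ _⟩ : (univ : Set (Icc (0 : ℝ) Real.pi)).Nonempty)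
      (B 0).continuous.continuousOn
    filter_upwards [hBa.continuousAt.tendsto.eventually
      (Metric.ball_mem_nhds (B 0) (hB0 θ₀))] with u hu θ
    have h1 : ‖(B u - B 0) θ‖ < B 0 θ₀ :=
      ((B u - B 0).norm_coe_le_norm θ).trans_lt (by simpa [dist_eq_norm] using hu)
    have h2 : B 0 θ₀ ≤ B 0 θ := hθ₀ (mem_univ θ)
    rw [ContinuousMap.sub_apply, Real.norm_eq_abs, abs_lt] at h1
    linarith [h1.1]
  have hunit {h : C(Icc (0 : ℝ) Real.pi, ℝ)} (hh : ∀ θ, 0 < h θ) : IsUnit h :=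
    ContinuousMap.isUnit_iff_forall_ne_zero h |>.2 fun θ => (hh θ).ne'
  refine ⟨p, q, fun u => (c * p' u + s * q' u) * Ring.inverse (B u), B, ?_, hBa, ?_,
    fun θ => ⟨hp0 θ, hq0 θ⟩, ?_⟩
  · obtain ⟨z, hz⟩ := hunit hB0
    refine ((analyticAt_const.mul hp'a).add (analyticAt_const.mul hq'a)).mul ?_
    refine AnalyticAt.fun_comp ?_ hBa
    rw [← hz]
    exact analyticAt_inverse z
  · have hfst : Tendsto (Prod.fst : ℝ × ℝ → ℝ) (𝓝 (0, 0)) (𝓝 0) := continuous_fst.tendsto (0, 0)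
    filter_upwards [eventually_forall_polar (by omega : n ≠ 0)
      ((hP.and hQ).and (hfst.eventually (hfF.and hgG)))] with r hr θ
    obtain ⟨⟨h1, h2⟩, h3, h4⟩ := hr θ
    rw [h1, h2, h3, h4]
    simp only [p, q]
    obtain ⟨m, rfl⟩ : ∃ m, n = m + 1 := ⟨n - 1, by omega⟩
    simp only [show 2 * (m + 1) - 1 = 2 * m + 1 by omega, Nat.add_sub_cancel]
    constructor <;> ring
  · filter_upwards [hpq, hBpos] with u h1 h2 θ
    refine ⟨by rw [hB, (h1 θ).1, (h1 θ).2], h2 θ, ?_⟩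
    rw [← ContinuousMap.mul_apply, mul_assoc, Ring.inverse_mul_cancel _ (hunit h2), mul_one]
    simp [c, s, h1 θ]

/-! ### The radial equation and its expansion in the initial value. -/

/-- Evaluation at a point is a continuous algebra homomorphism, hence commutes with the exponential
series. -/
theorem ContinuousMap.exp_apply {X : Type*} [TopologicalSpace X] [CompactSpace X] (w : C(X, ℝ))
    (θ : X) : NormedSpace.exp w θ = Real.exp (w θ) := by
  have := NormedSpace.map_exp (ContinuousMap.evalAlgHom ℝ ℝ θ : C(X, ℝ) →ₐ[ℝ] ℝ)
    (continuous_eval_const θ) w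
  rw [Real.exp_eq_exp_ℝ]
  exact this

/-- The coefficients of `x` times a power series. -/
def mulXCoeff {E : Type*} [Zero E] (c : ℕ → E) : ℕ → E
  | 0 => 0
  | i + 1 => c i

theorem hasSum_mulXCoeff {E : Type*} [NormedAddCommGroup E] [NormedSpace ℝ E] {c : ℕ → E} {x : ℝ}
    {s : E} (h : HasSum (fun i => x ^ i • c i) s) :
    HasSum (fun i => x ^ i • mulXCoeff c i) (x • s) := by
  refine (hasSum_nat_add_iff' 1).1 ?_
  simpa [mulXCoeff, pow_succ', mul_smul] using h.const_smul x

/-- The function `x exp(∫₀^θ h)` solves `r' = r h`. -/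
theorem hasDerivAt_exp_integral (h : C(Icc (0 : ℝ) Real.pi, ℝ)) (x θ : ℝ) :
    HasDerivAt (fun t => x * Real.exp (∫ s in (0 : ℝ)..t, IccExtend Real.pi_nonneg h s))
      (x * Real.exp (∫ s in (0 : ℝ)..θ, IccExtend Real.pi_nonneg h s)
        * IccExtend Real.pi_nonneg h θ) θ := by
  rw [mul_assoc]
  exact ((hasDerivAt_integral_IccExtend h θ).exp).const_mul x

/-- This passes from the logarithmic form `v = ∫ h` to `r = x + ∫ r h`. The latter is linear in `r`
and `r h`, so that power series in `x` can be compared term by term. -/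
theorem smul_exp_eq_add_volterra {v h : C(Icc (0 : ℝ) Real.pi, ℝ)} (hv : v = volterra h) (x : ℝ) :
    x • NormedSpace.exp v = x • (1 : C(Icc (0 : ℝ) Real.pi, ℝ))
      + volterra ((x • NormedSpace.exp v) * h) := by
  have hval : ∀ θ : Icc (0 : ℝ) Real.pi, (x • NormedSpace.exp v) θ =
      x * Real.exp (∫ s in (0 : ℝ)..θ, IccExtend Real.pi_nonneg h s) := fun θ => by
    rw [ContinuousMap.smul_apply, ContinuousMap.exp_apply, hv, volterra_apply, smul_eq_mul]
  obtain ⟨k, hk⟩ : ∃ k, k = (x • NormedSpace.exp v) * h := ⟨_, rfl⟩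
  rw [← hk]
  ext θ
  have hc : Continuous (IccExtend Real.pi_nonneg k) := k.continuous.Icc_extend'
  have h1 := intervalIntegral.integral_eq_sub_of_hasDerivAt (a := 0) (b := (θ : ℝ))
    (f' := IccExtend Real.pi_nonneg k)
    (f := fun t => x * Real.exp (∫ s in (0 : ℝ)..t, IccExtend Real.pi_nonneg h s))
    (fun t ht => by
      rw [uIcc_of_le θ.2.1] at ht
      have ht' : t ∈ Icc (0 : ℝ) Real.pi := ⟨ht.1, ht.2.trans θ.2.2⟩
      have := hasDerivAt_exp_integral h x t
      rw [IccExtend_of_mem _ h ht'] at this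
      rwa [IccExtend_of_mem _ k ht', hk, ContinuousMap.mul_apply, hval])
    (hc.intervalIntegrable _ _)
  rw [ContinuousMap.add_apply, volterra_apply, h1, hval]
  simp

/-- The radial equation `dr/dθ = r h(r, θ)` on `[0, π]`: the solution `x exp (v x)` with initial
value `x` is analytic in `x`, and the coefficients of its power series solve the triangular system
of the focal coefficients. -/
theorem exists_radial_solution {H : C(Icc (0 : ℝ) Real.pi, ℝ) → C(Icc (0 : ℝ) Real.pi, ℝ)}
    (hH : AnalyticAt ℝ H 0) {h : ℝ → ℝ → ℝ}
    (hh : ∀ᶠ u in 𝓝 (0 : C(Icc (0 : ℝ) Real.pi, ℝ)), ∀ θ, H u θ = h (u θ) θ) :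
    ∃ (v : ℝ → C(Icc (0 : ℝ) Real.pi, ℝ)) (C R : ℕ → ℝ → ℝ),
      AnalyticAt ℝ v 0 ∧ v 0 = volterra (H 0) ∧
      (∀ᶠ x in 𝓝 0, v x = volterra (H (x • NormedSpace.exp (v x)))) ∧
      (∀ θ ∈ Icc 0 Real.pi, ∀ᶠ r in 𝓝 (0 : ℝ),
        HasSum (fun j : ℕ => C (j + 1) θ * r ^ (j + 1)) (r * h r θ)) ∧
      (∀ θ, R 0 θ = 0) ∧ R 1 0 = 1 ∧ (∀ i, 2 ≤ i → R i 0 = 0) ∧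
      (∀ i, 1 ≤ i → ∀ θ ∈ Icc 0 Real.pi,
        HasDerivWithinAt (R i)
          (∑ j ∈ Finset.Icc 1 i,
            C j θ * PowerSeries.coeff i ((PowerSeries.mk fun k => R k θ) ^ j))
          (Icc 0 Real.pi) θ) ∧
      (∀ θ : Icc (0 : ℝ) Real.pi, R 1 θ = Real.exp (v 0 θ)) ∧
      ∀ᶠ x in 𝓝 0, ∀ θ : Icc (0 : ℝ) Real.pi,
        HasSum (fun i : ℕ => R (i + 1) θ * x ^ (i + 1)) (x * Real.exp (v x θ)) := by
  obtain ⟨v, hva, hv0, hv⟩ := exists_analyticAt_eq_exp_smul volterra hH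
  have hwa : AnalyticAt ℝ (fun x => NormedSpace.exp (v x)) 0 :=
    AnalyticAt.fun_comp (NormedSpace.exp_analytic _) hva
  let u : ℝ → C(Icc (0 : ℝ) Real.pi, ℝ) := fun x => x • NormedSpace.exp (v x)
  have hua : AnalyticAt ℝ u 0 := analyticAt_id.smul hwa
  have hu0 : u 0 = 0 := zero_smul _ _
  have hut : Tendsto u (𝓝 0) (𝓝 0) := by simpa [hu0] using hua.continuousAt.tendsto
  have hSa : AnalyticAt ℝ (fun x => u x * H (u x)) 0 :=
    hua.mul (AnalyticAt.fun_comp (by rwa [hu0]) hua)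
  have h1a : AnalyticAt ℝ (fun r : ℝ => r • (1 : C(Icc (0 : ℝ) Real.pi, ℝ))) 0 :=
    analyticAt_id.smul analyticAt_const
  have hca : AnalyticAt ℝ (fun r : ℝ => H (r • (1 : C(Icc (0 : ℝ) Real.pi, ℝ)))) 0 :=
    AnalyticAt.fun_comp (by simpa using hH) h1a
  obtain ⟨W, hW⟩ := hwa.exists_hasSum_pow_smul
  obtain ⟨c, hc⟩ := hca.exists_hasSum_pow_smul
  obtain ⟨N, hN⟩ := hSa.exists_hasSum_pow_smul
  have h1t : Tendsto (fun r : ℝ => r • (1 : C(Icc (0 : ℝ) Real.pi, ℝ))) (𝓝 0) (𝓝 0) := by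
    simpa using h1a.continuousAt.tendsto
  have hW0 : W 0 = NormedSpace.exp (v 0) := by
    have := hW.self_of_nhds
    refine HasSum.unique ?_ this
    convert! hasSum_single (f := fun i => (0 : ℝ) ^ i • W i) 0 (fun i hi => by simp [hi]) using 1
    simp
  have hR : ∀ᶠ x in 𝓝 0, HasSum (fun i => x ^ i • mulXCoeff W i) (u x) :=
    hW.mono fun x hx => hasSum_mulXCoeff hx
  -- Coefficient comparison in `u = x + ∫ u H(u)`: this is the triangular system in integrated form,
  -- with `N i` still to be computed.
  have hRN : mulXCoeff W
      = fun i => (if i = 1 then (1 : C(Icc (0 : ℝ) Real.pi, ℝ)) else 0) + volterra (N i) := by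
    refine eq_of_eventually_hasSum_pow_smul hR ?_
    filter_upwards [hv, hN] with x hx hNx
    have h1 := hNx.map volterra volterra.continuous
    have h2 : HasSum (fun i => x ^ i • if i = 1 then (1 : C(Icc (0 : ℝ) Real.pi, ℝ)) else 0)
        (x • 1) := by
      convert! hasSum_single (f := fun i => x ^ i •
        if i = 1 then (1 : C(Icc (0 : ℝ) Real.pi, ℝ)) else 0) 1 (fun i hi => by simp [hi]) using 1
      simp
    have h3 := h2.add h1
    rw [← smul_exp_eq_add_volterra hx x] at h3
    refine h3.congr_fun fun i => ?_
    simp [smul_add]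
  -- Applying `H` to constant functions `r • 1` recovers the expansion of `h r θ` in the real
  -- variable `r`.
  have hCs : ∀ θ : Icc (0 : ℝ) Real.pi, ∀ᶠ r in 𝓝 (0 : ℝ),
      HasSum (fun j => r ^ j • mulXCoeff (fun j => c j θ) j) (r * h r θ) := by
    intro θ
    filter_upwards [hc, h1t.eventually hh] with r hr hr'
    have h1 := hr.map (ContinuousMap.evalCLM ℝ θ : C(Icc (0 : ℝ) Real.pi, ℝ) →L[ℝ] ℝ)
      (ContinuousLinearMap.continuous _)
    have h2 : HasSum (fun j => r ^ j • c j θ) (h r θ) := by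
      have := hr' θ
      rw [ContinuousMap.smul_apply, ContinuousMap.one_apply, smul_eq_mul, mul_one] at this
      rw [← this]
      exact h1
    exact hasSum_mulXCoeff h2
  have hRs : ∀ᶠ x in 𝓝 (0 : ℝ), ∀ θ : Icc (0 : ℝ) Real.pi,
      HasSum (fun i => x ^ i • mulXCoeff W i θ) (u x θ) := by
    filter_upwards [hR] with x hx θ
    exact hx.map (ContinuousMap.evalCLM ℝ θ : C(Icc (0 : ℝ) Real.pi, ℝ) →L[ℝ] ℝ)
      (ContinuousLinearMap.continuous _)
  -- At fixed `θ`, both sides are the coefficients of the same function of `x`, the right one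
  -- computed by composing series.
  have hNs : ∀ (θ : Icc (0 : ℝ) Real.pi) (i : ℕ), N i θ = ∑ j ∈ Finset.range (i + 1),
      mulXCoeff (fun j => c j θ) j *
        PowerSeries.coeff i ((PowerSeries.mk fun k => mulXCoeff W k θ) ^ j) := by
    intro θ
    refine congrFun (eq_of_eventually_hasSum_pow_smul (f := fun x => u x θ * h (u x θ) θ) ?_ ?_)
    · filter_upwards [hN, hut.eventually hh] with x hx hx'
      rw [← hx' θ]
      exact hx.map (ContinuousMap.evalCLM ℝ θ : C(Icc (0 : ℝ) Real.pi, ℝ) →L[ℝ] ℝ)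
        (ContinuousLinearMap.continuous _)
    · exact eventually_hasSum_comp (f := fun r => r * h r θ) (u := fun x => u x θ) rfl rfl (hCs θ)
        (hRs.mono fun x hx => hx θ)
  have hext {f : C(Icc (0 : ℝ) Real.pi, ℝ)} {θ : ℝ} (hθ : θ ∈ Icc 0 Real.pi) :
      IccExtend Real.pi_nonneg f θ = f ⟨θ, hθ⟩ := IccExtend_of_mem _ _ hθ
  have hzero : (0 : ℝ) ∈ Icc 0 Real.pi := ⟨le_rfl, Real.pi_nonneg⟩
  have hRval (i : ℕ) {θ : ℝ} (hθ : θ ∈ Icc 0 Real.pi) :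
      mulXCoeff W i ⟨θ, hθ⟩ = (if i = 1 then 1 else 0)
        + ∫ s in (0 : ℝ)..θ, IccExtend Real.pi_nonneg (N i) s := by
    rw [congrFun hRN i, ContinuousMap.add_apply, volterra_apply]
    split_ifs <;> rfl
  refine ⟨v, fun j => mulXCoeff (fun j => IccExtend Real.pi_nonneg (c j)) j,
    fun i => IccExtend Real.pi_nonneg ⇑(mulXCoeff W i), hva, hv0, hv, ?_, fun θ => rfl, ?_, ?_, ?_,
    ?_, ?_⟩
  · intro θ hθ
    filter_upwards [hCs ⟨θ, hθ⟩] with r hr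
    have := (hasSum_nat_add_iff' 1).2 hr
    simp only [mulXCoeff, Finset.range_one, Finset.sum_singleton, smul_eq_mul, mul_zero,
      sub_zero] at this
    refine this.congr_fun fun j => ?_
    simp only [mulXCoeff]
    rw [hext hθ, mul_comm]
  · beta_reduce; rw [hext hzero, hRval]; simp
  · intro i hi
    beta_reduce; rw [hext hzero, hRval, if_neg (by omega)]; simp
  · intro i hi θ hθ
    have h1 := ((hasDerivAt_integral_IccExtend (N i) θ).const_add
      (if i = 1 then 1 else 0)).hasDerivWithinAt (s := Icc 0 Real.pi)
    have h2 : IccExtend Real.pi_nonneg (N i) θ = ∑ j ∈ Finset.Icc 1 i,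
        mulXCoeff (fun j => IccExtend Real.pi_nonneg (c j)) j θ * PowerSeries.coeff i
          ((PowerSeries.mk fun k => IccExtend Real.pi_nonneg ⇑(mulXCoeff W k) θ) ^ j) := by
      have h3 : ∀ j, mulXCoeff (fun j => IccExtend Real.pi_nonneg (c j)) j θ
          = mulXCoeff (fun j => c j ⟨θ, hθ⟩) j := by
        intro j
        rcases j with _ | j
        · rfl
        · exact hext hθ
      simp_rw [h3, hext hθ]
      rw [hNs]
      refine (Finset.sum_subset ?_ ?_).symm
      · intro j hj
        simp only [Finset.mem_Icc, Finset.mem_range] at hj ⊢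
        omega
      · intro j hj hj'
        simp only [Finset.mem_Icc, Finset.mem_range] at hj hj'
        obtain rfl : j = 0 := by omega
        simp [mulXCoeff]
    rw [← h2]
    refine h1.congr (fun t ht => ?_) ?_
    · beta_reduce; rw [hext ht, hRval]
    · beta_reduce; rw [hext hθ, hRval]
  · intro θ
    beta_reduce; rw [IccExtend_val]
    simp [mulXCoeff, hW0, ContinuousMap.exp_apply]
  · filter_upwards [hRs] with x hx θ
    have := (hasSum_nat_add_iff' 1).2 (hx θ)
    simp only [Finset.range_one, Finset.sum_singleton, smul_eq_mul] at this
    rw [show mulXCoeff W 0 θ = 0 from rfl, mul_zero, sub_zero,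
      show u x θ = x * Real.exp (v x θ) by
        simp [u, ContinuousMap.exp_apply]] at this
    refine this.congr_fun fun i => ?_
    rw [IccExtend_val, mul_comm]

/-! ### From the radial solution to a planar orbit. -/

/-- A primitive of a positive function on `[0, π]`, extended to the line, is invertible. -/
theorem exists_inverse_integral {k : C(Icc (0 : ℝ) Real.pi, ℝ)} (hk : ∀ θ, 0 < k θ) :
    ∃ e : ℝ ≃o ℝ, (∀ t, e t = ∫ s in (0 : ℝ)..t, IccExtend Real.pi_nonneg k s) ∧
      ∀ s, HasDerivAt e.symm (IccExtend Real.pi_nonneg k (e.symm s))⁻¹ s := by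
  obtain ⟨T, hT⟩ : ∃ T : ℝ → ℝ, T = fun t => ∫ s in (0 : ℝ)..t, IccExtend Real.pi_nonneg k s :=
    ⟨_, rfl⟩
  have hT0 : T 0 = 0 := by rw [hT]; simp
  have hder (t : ℝ) : HasDerivAt T (IccExtend Real.pi_nonneg k t) t := by
    rw [hT]; exact hasDerivAt_integral_IccExtend k t
  have hmono : StrictMono T := strictMono_of_deriv_pos fun t => by
    rw [(hder t).deriv]; exact hk _
  obtain ⟨θ₀, -, hθ₀⟩ := isCompact_univ.exists_isMinOn
    (⟨⟨0, by simp [Real.pi_nonneg]⟩, mem_univ _⟩ : (univ : Set (Icc (0 : ℝ) Real.pi)).Nonempty)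
    k.continuous.continuousOn
  have hmono' : Monotone fun t => T t - k θ₀ * t := by
    have hd (t : ℝ) : HasDerivAt (fun t => T t - k θ₀ * t)
        (IccExtend Real.pi_nonneg k t - k θ₀ * 1) t :=
      -- The integrand is at least its minimum `k θ₀ > 0`, so `T` grows at least linearly in both
      -- directions and is onto.
      (hder t).sub ((hasDerivAt_id t).const_mul _)
    refine monotone_of_deriv_nonneg (fun t => (hd t).differentiableAt) fun t => ?_
    rw [(hd t).deriv, mul_one, sub_nonneg]
    exact hθ₀ (mem_univ _)
  have htop : Tendsto T atTop atTop := by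
    refine tendsto_atTop_mono' _ ?_ (tendsto_id.const_mul_atTop (hk θ₀))
    filter_upwards [eventually_ge_atTop 0] with t ht
    have := hmono' ht
    simp only [hT0, id] at this ⊢
    linarith
  have hbot : Tendsto T atBot atBot := by
    refine tendsto_atBot_mono' _ ?_ (tendsto_id.const_mul_atBot (hk θ₀))
    filter_upwards [eventually_le_atBot 0] with t ht
    have := hmono' ht
    simp only [hT0, id] at this ⊢
    linarith
  have hcont : Continuous T := continuous_iff_continuousAt.2 fun t => (hder t).continuousAt
  let e : ℝ ≃o ℝ := hmono.orderIsoOfSurjective T (hcont.surjective htop hbot)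
  have he : ∀ t, e t = T t := fun t => rfl
  refine ⟨e, fun t => by rw [he, hT], fun s => ?_⟩
  refine HasDerivAt.of_local_left_inverse e.symm.continuous.continuousAt (hder _) (hk _).ne' ?_
  exact Eventually.of_forall fun y => by rw [← he, e.apply_symm_apply]

/-- A solution of the radial equation on `[0, π]` gives a half-return of the planar system. -/
theorem isHalfReturn_of_polar {U : Set (ℝ × ℝ)} {P Q : ℝ × ℝ → ℝ} {n : ℕ} (hn : 1 ≤ n) {x : ℝ}
    (hx : 0 < x) {h b k : C(Icc (0 : ℝ) Real.pi, ℝ)} {p q : ℝ → ℝ}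
    (hbpos : ∀ θ, 0 < b θ) (hkpos : ∀ θ, 0 < k θ)
    (hb : ∀ θ, b θ = Real.cos θ * q θ - n * Real.sin θ * p θ)
    (hh : ∀ θ, h θ * b θ = Real.cos θ * p θ + Real.sin θ * q θ)
    (hk : ∀ θ, k θ * ((x * Real.exp (volterra h θ)) ^ (n - 1) * b θ)
      = Real.cos θ ^ 2 + n * Real.sin θ ^ 2)
    (hU : ∀ θ : Icc (0 : ℝ) Real.pi, (x * Real.exp (volterra h θ) * Real.cos θ,
      (x * Real.exp (volterra h θ)) ^ n * Real.sin θ) ∈ U)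
    (hP : ∀ θ : Icc (0 : ℝ) Real.pi, P (x * Real.exp (volterra h θ) * Real.cos θ,
      (x * Real.exp (volterra h θ)) ^ n * Real.sin θ) = (x * Real.exp (volterra h θ)) ^ n * p θ)
    (hQ : ∀ θ : Icc (0 : ℝ) Real.pi, Q (x * Real.exp (volterra h θ) * Real.cos θ,
      (x * Real.exp (volterra h θ)) ^ n * Real.sin θ)
        = (x * Real.exp (volterra h θ)) ^ (2 * n - 1) * q θ) :
    IsHalfReturn U P Q x (volterra k ⟨Real.pi, Real.pi_nonneg, le_rfl⟩)
      (-(x * Real.exp (volterra h ⟨Real.pi, Real.pi_nonneg, le_rfl⟩))) := by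
  -- Since `k = dt/dθ`, the map `e` sends angle to time, and the orbit is parametrized by `e.symm`.
  obtain ⟨e, he, he'⟩ := exists_inverse_integral hkpos
  obtain ⟨ρ, hρ⟩ : ∃ ρ : ℝ → ℝ, ∀ t, ρ t =
      x * Real.exp (∫ s in (0 : ℝ)..t, IccExtend Real.pi_nonneg h s) := ⟨_, fun _ => rfl⟩
  have hρder (t : ℝ) : HasDerivAt ρ (ρ t * IccExtend Real.pi_nonneg h t) t := by
    rw [hρ, funext hρ]; exact hasDerivAt_exp_integral h x t
  have hρpos (t : ℝ) : 0 < ρ t := by rw [hρ]; positivity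
  have hρv (θ : Icc (0 : ℝ) Real.pi) : x * Real.exp (volterra h θ) = ρ θ := by
    rw [hρ, volterra_apply]
  simp only [hρv] at hk hU hP hQ ⊢
  have he0 : e 0 = 0 := by rw [he]; simp
  have hes0 : e.symm 0 = 0 := by rw [e.symm_apply_eq, he0]
  have hτ : volterra k ⟨Real.pi, Real.pi_nonneg, le_rfl⟩ = e Real.pi := by
    rw [he, volterra_apply]
  have hτpos : 0 < e Real.pi := by
    rw [← he0]; exact e.strictMono Real.pi_pos
  rw [hτ]
  refine ⟨hτpos.ne', fun t => (ρ (e.symm t) * Real.cos (e.symm t),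
    ρ (e.symm t) ^ n * Real.sin (e.symm t)), ?_, ?_, ?_, ?_⟩
  · simp [hes0, hρ]
  · simp
  · intro s hs
    rw [uIcc_of_le hτpos.le] at hs
    have hmem : e.symm s ∈ Icc 0 Real.pi := by
      constructor
      · rw [← hes0]; exact e.symm.monotone hs.1
      · rw [← e.symm_apply_apply Real.pi]; exact e.symm.monotone hs.2
    obtain ⟨θ, hθ⟩ : ∃ θ : Icc (0 : ℝ) Real.pi, (θ : ℝ) = e.symm s := ⟨⟨_, hmem⟩, rfl⟩
    have hd := he' s
    have hr := (hρder (e.symm s)).comp s hd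
    have hc := hd.cos
    have hs := hd.sin
    rw [← hθ, IccExtend_val] at hd hr
    have hc' := hr.mul hc
    have hs' := (hr.pow n).mul hs
    refine ⟨by beta_reduce; rw [← hθ]; exact hU θ, HasDerivAt.hasDerivWithinAt ?_⟩
    have hb0 := (hbpos θ).ne'
    have hk0 := (hkpos θ).ne'
    have hρn : ρ θ ^ n = ρ θ ^ (n - 1) * ρ θ := by rw [← pow_succ, Nat.sub_add_cancel hn]
    have hρ2n : ρ θ ^ (2 * n - 1) = ρ θ ^ n * ρ θ ^ (n - 1) := by
      rw [← pow_add]; congr 1; omega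
    -- `e1` and `e2` are the equations `x' = P` and `y' = Q` cleared of powers of `ρ`. After
    -- multiplication by `b` they follow from the relations for `h`, `b` and `k`.
    have e1 : h θ * Real.cos θ - Real.sin θ = p θ * k θ * ρ θ ^ (n - 1) := by
      refine mul_right_cancel₀ hb0 ?_
      linear_combination Real.cos θ * hh θ - Real.sin θ * hb θ - p θ * hk θ
    have e2 : n * h θ * Real.sin θ + Real.cos θ = q θ * k θ * ρ θ ^ (n - 1) := by
      refine mul_right_cancel₀ hb0 ?_
      linear_combination n * Real.sin θ * hh θ + Real.cos θ * hb θ - q θ * hk θ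
    refine (hc'.prodMk hs').congr_deriv ?_
    simp only [Function.comp_apply, Pi.pow_apply]
    rw [← hθ, IccExtend_val, hP, hQ]
    refine Prod.ext ?_ ?_
    · simp only
      field_simp
      rw [hρn]
      linear_combination ρ θ * e1
    · simp only
      field_simp
      rw [hρ2n, hρn]
      linear_combination ρ θ ^ (n - 1) * ρ θ * e2
  · intro s hs
    rw [min_eq_left hτpos.le, max_eq_right hτpos.le] at hs
    have h1 : 0 < e.symm s := by rw [← hes0]; exact e.symm.strictMono hs.1
    have h2 : e.symm s < Real.pi := by
      rw [← e.symm_apply_apply Real.pi]; exact e.symm.strictMono hs.2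
    exact mul_pos (pow_pos (hρpos _) n) (Real.sin_pos_of_pos_of_lt_pi h1 h2)

/-! ### Uniqueness of the half-return. -/

/-- Uniqueness of solutions in an open set on which the vector field is `C¹`. -/
theorem eqOn_of_hasDerivWithinAt_of_contDiffAt {E : Type*} [NormedAddCommGroup E]
    [NormedSpace ℝ E] {Z : E → E} {U : Set E} (hZ : ∀ z ∈ U, ContDiffAt ℝ 1 Z z) {T : ℝ}
    {γ δ : ℝ → E} (hγ : ∀ s ∈ Icc 0 T, γ s ∈ U ∧ HasDerivWithinAt γ (Z (γ s)) (Icc 0 T) s)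
    (hδ : ∀ s ∈ Icc 0 T, δ s ∈ U ∧ HasDerivWithinAt δ (Z (δ s)) (Icc 0 T) s)
    (h0 : γ 0 = δ 0) : EqOn γ δ (Icc 0 T) := by
  have hγc : ContinuousOn γ (Icc 0 T) := fun s hs => (hγ s hs).2.continuousWithinAt
  have hδc : ContinuousOn δ (Icc 0 T) := fun s hs => (hδ s hs).2.continuousWithinAt
  have hK : IsCompact (γ '' Icc 0 T ∪ δ '' Icc 0 T) :=
    (isCompact_Icc.image_of_continuousOn hγc).union (isCompact_Icc.image_of_continuousOn hδc)
  have hKU : γ '' Icc 0 T ∪ δ '' Icc 0 T ⊆ U := by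
    rintro _ (⟨s, hs, rfl⟩ | ⟨s, hs, rfl⟩)
    exacts [(hγ s hs).1, (hδ s hs).1]
  -- On the compact union of the two orbits, local Lipschitz bounds give a single Lipschitz
  -- constant.
  have hloc : LocallyLipschitzOn (γ '' Icc 0 T ∪ δ '' Icc 0 T) Z := by
    intro z hz
    obtain ⟨L, t, ht, hL⟩ := (hZ z (hKU hz)).exists_lipschitzOnWith
    exact ⟨L, t, nhdsWithin_le_nhds ht, hL⟩
  obtain ⟨L, hL⟩ := hloc.exists_lipschitzOnWith_of_compact hK
  have hside {f : ℝ → E} {f' : E} {s : ℝ} (hs : s ∈ Ico 0 T)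
      (hf : HasDerivWithinAt f f' (Icc 0 T) s) : HasDerivWithinAt f f' (Ici s) s := by
    refine hf.mono_of_mem_nhdsWithin ?_
    exact mem_of_superset (Icc_mem_nhdsGE hs.2) (Icc_subset_Icc_left hs.1)
  exact ODE_solution_unique_of_mem_Icc_right (v := fun _ => Z)
    (s := fun _ => γ '' Icc 0 T ∪ δ '' Icc 0 T) (fun _ _ => hL) hγc
    (fun s hs => hside hs (hγ s (Ico_subset_Icc_self hs)).2)
    (fun s hs => Or.inl ⟨s, Ico_subset_Icc_self hs, rfl⟩) hδc
    (fun s hs => hside hs (hδ s (Ico_subset_Icc_self hs)).2)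
    (fun s hs => Or.inr ⟨s, Ico_subset_Icc_self hs, rfl⟩) h0

/-- Where the orbit crosses `{y = 0}` upwards, the half-return through `{y > 0}` is forward in
time. -/
theorem IsHalfReturn.pos {U : Set (ℝ × ℝ)} {P Q : ℝ × ℝ → ℝ} {x t z : ℝ}
    (h : IsHalfReturn U P Q x t z) (hQ : 0 < Q (x, 0)) : 0 < t := by
  obtain ⟨ht, γ, h0, -, hγ, hpos⟩ := h
  by_contra hneg
  have ht' : t < 0 := lt_of_le_of_ne (not_lt.1 hneg) ht
  rw [uIcc_of_ge ht'.le] at hγ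
  rw [min_eq_right ht'.le, max_eq_left ht'.le] at hpos
  have hd := (hγ 0 ⟨ht'.le, le_rfl⟩).2
  rw [h0] at hd
  have hd2 : HasDerivWithinAt (fun s => (γ s).2) (Q (x, 0)) (Icc t 0) 0 := hd.snd
  -- For `t < 0` the left slopes of `y` at time `0` would be eventually positive, although `y > 0`
  -- just before and `y = 0` at time `0`.
  have hd3 : HasDerivWithinAt (fun s => (γ s).2) (Q (x, 0)) (Iio 0) 0 :=
    (hd2.mono_of_mem_nhdsWithin (Icc_mem_nhdsLE ht')).mono Iio_subset_Iic_self
  rw [hasDerivWithinAt_iff_tendsto_slope' (by simp)] at hd3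
  obtain ⟨s, hs1, hs2⟩ := ((hd3.eventually_const_lt hQ).and (Ioo_mem_nhdsLT ht')).exists
  rw [slope_def_field, h0, sub_zero, sub_zero] at hs1
  have := hpos s hs2
  exact absurd hs1 (not_lt.2 (div_nonpos_of_nonneg_of_nonpos this.le hs2.2.le))

/-- Both orbits run forward and coincide up to the shorter time. If the times differed, the longer
orbit would meet `{y = 0}` at an intermediate time. -/
theorem IsHalfReturn.unique {U : Set (ℝ × ℝ)} {P Q : ℝ × ℝ → ℝ}
    (hP : AnalyticOnNhd ℝ P U) (hQ : AnalyticOnNhd ℝ Q U) {x t z t' z' : ℝ}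
    (h : IsHalfReturn U P Q x t z) (h' : IsHalfReturn U P Q x t' z') (hx : 0 < Q (x, 0)) :
    t = t' ∧ z = z' := by
  wlog hle : t ≤ t' generalizing t z t' z'
  · have := this h' h (not_le.1 hle).le
    exact ⟨this.1.symm, this.2.symm⟩
  have ht := h.pos hx
  have ht' := h'.pos hx
  obtain ⟨-, γ, h0, h1, hγ, -⟩ := h
  obtain ⟨-, δ, h0', h1', hδ, hpos⟩ := h'
  rw [uIcc_of_le ht.le] at hγ
  rw [uIcc_of_le ht'.le] at hδ
  have heq : EqOn γ δ (Icc 0 t) := by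
    refine eqOn_of_hasDerivWithinAt_of_contDiffAt (Z := fun z => (P z, Q z)) (U := U)
      (fun z hz => ((hP z hz).contDiffAt).prodMk ((hQ z hz).contDiffAt)) hγ (fun s hs => ?_)
      (h0.trans h0'.symm)
    have hs' : s ∈ Icc 0 t' := ⟨hs.1, hs.2.trans hle⟩
    exact ⟨(hδ s hs').1, (hδ s hs').2.mono (Icc_subset_Icc_right hle)⟩
  have h2 : δ t = (z, 0) := by rw [← heq ⟨ht.le, le_rfl⟩, h1]
  rcases hle.eq_or_lt with rfl | hlt
  · refine ⟨rfl, ?_⟩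
    rw [h1'] at h2
    exact (congrArg Prod.fst h2).symm
  · have := hpos t (by rw [min_eq_left ht'.le, max_eq_right ht'.le]; exact ⟨ht, hlt⟩)
    rw [h2] at this
    exact absurd this (lt_irrefl _)

/-! ### The half-return map, its focal coefficients and the flight time. -/

theorem ContinuousMap.eventually_forall_apply {X : Type*} [TopologicalSpace X] [CompactSpace X]
    {Φ : ℝ → Prop} (hΦ : ∀ᶠ r in 𝓝 (0 : ℝ), Φ r) : ∀ᶠ u in 𝓝 (0 : C(X, ℝ)), ∀ θ, Φ (u θ) := by
  obtain ⟨ε, hε, hball⟩ := Metric.eventually_nhds_iff.1 hΦ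
  filter_upwards [Metric.ball_mem_nhds (0 : C(X, ℝ)) hε] with u hu θ
  refine hball ?_
  rw [dist_zero_right]
  exact (u.norm_coe_le_norm θ).trans_lt (by simpa using hu)

theorem volterra_pos {k : C(Icc (0 : ℝ) Real.pi, ℝ)} (hk : ∀ θ, 0 < k θ) :
    0 < volterra k ⟨Real.pi, Real.pi_nonneg, le_rfl⟩ := by
  obtain ⟨e, he, -⟩ := exists_inverse_integral hk
  have h0 : e 0 = 0 := by rw [he]; simp
  have := e.strictMono Real.pi_pos
  rwa [h0, he] at this

/-- The angular equation in blown-up polar coordinates. -/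
theorem blowupR_div_blowupTheta {n : ℕ} (hn : 1 ≤ n) {P Q : ℝ × ℝ → ℝ} {r θ p q : ℝ} (hr : 0 < r)
    (hP : P (r * Real.cos θ, r ^ n * Real.sin θ) = r ^ n * p)
    (hQ : Q (r * Real.cos θ, r ^ n * Real.sin θ) = r ^ (2 * n - 1) * q)
    (hb : Real.cos θ * q - n * Real.sin θ * p ≠ 0) :
    blowupR n P Q r θ / blowupTheta n P Q r θ
      = r * ((Real.cos θ * p + Real.sin θ * q) / (Real.cos θ * q - n * Real.sin θ * p)) := by
  have hD : Real.cos θ ^ 2 + n * Real.sin θ ^ 2 ≠ 0 := by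
    have h1 : (1 : ℝ) ≤ n := by exact_mod_cast hn
    have h2 := Real.sin_sq_add_cos_sq θ
    nlinarith [sq_nonneg (Real.sin θ)]
  have hR : blowupR n P Q r θ = r ^ n * (Real.cos θ * p + Real.sin θ * q)
      / (Real.cos θ ^ 2 + n * Real.sin θ ^ 2) := by
    rw [blowupR, hP, hQ, div_eq_div_iff (by positivity) hD]
    obtain ⟨m, rfl⟩ : ∃ m, n = m + 1 := ⟨n - 1, by omega⟩
    simp only [show 2 * (m + 1) - 1 = 2 * m + 1 by omega]
    ring
  have hT : blowupTheta n P Q r θ = r ^ (n - 1) * (Real.cos θ * q - n * Real.sin θ * p)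
      / (Real.cos θ ^ 2 + n * Real.sin θ ^ 2) := by
    rw [blowupTheta, hP, hQ, div_eq_div_iff (by positivity) hD]
    obtain ⟨m, rfl⟩ : ∃ m, n = m + 1 := ⟨n - 1, by omega⟩
    simp only [show 2 * (m + 1) - 1 = 2 * m + 1 by omega, Nat.add_sub_cancel]
    ring
  rw [hR, hT]
  obtain ⟨m, rfl⟩ : ∃ m, n = m + 1 := ⟨n - 1, by omega⟩
  rw [div_div_div_cancel_right₀ hD, Nat.add_sub_cancel, pow_succ, mul_assoc,
    mul_div_mul_left _ _ (by positivity), mul_div_assoc]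

theorem mainTheorem9 (U : Set (ℝ × ℝ)) (hU : IsOpen U) (h0 : (0, 0) ∈ U)
    (P Q : ℝ × ℝ → ℝ) (hP : AnalyticOnNhd ℝ P U) (hQ : AnalyticOnNhd ℝ Q U)
    (n β : ℕ) (a b : ℝ) (hZ : IsAndreevNormalForm n β a b P Q)
    (ν : ℝ) (hν : ν = if β = n - 1 then b else 0) :
    ∃ (x₀ : ℝ) (φ τ : ℝ → ℝ) (α T : ℕ → ℝ), 0 < x₀ ∧
      -- `φ` is the half-return map and `τ` the flight time
      (∀ x ∈ Ioo 0 x₀, ∀ t z : ℝ, IsHalfReturn U P Q x t z ↔ t = τ x ∧ z = φ x) ∧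
      (∀ x ∈ Ioo 0 x₀, φ x < 0) ∧
      -- `φ` is analytic, also at the endpoint `0`, with the expansion `-α₁ x - ∑_{i ≥ 2} αᵢ xⁱ`
      φ 0 = 0 ∧ AnalyticOnNhd ℝ φ (Ico 0 x₀) ∧
      (∀ x ∈ Ico 0 x₀, HasSum (fun i : ℕ => -(α (i + 1) * x ^ (i + 1))) (φ x)) ∧
      -- the `αᵢ` are the focal coefficients
      IsFocalCoefficients n P Q α ∧
      α 1 = Real.exp (∫ θ in (0 : ℝ)..Real.pi,
        (a * Real.sin θ * Real.cos θ ^ (2 * n - 1) - Real.sin θ * Real.cos θ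
            + ν * Real.sin θ ^ 2 * Real.cos θ ^ (n - 1))
          / (a * Real.cos θ ^ (2 * n) + n * Real.sin θ ^ 2
            + ν * Real.cos θ ^ n * Real.sin θ)) ∧
      -- the flight time
      0 < T 0 ∧
      ∀ x ∈ Ioo 0 x₀, HasSum (fun i : ℕ => T i * x ^ ((i : ℤ) + 1 - (n : ℤ))) (τ x) := by
  have hn : 2 ≤ n := hZ.two_le
  obtain ⟨p, q, H, B, hHa, hBa, hpq, hpq0, hHB⟩ := hZ.exists_polar hν
  obtain ⟨v, C, R, hva, hv0, hv, hC, hR0, hR1, hR2, hRd, hR1v, hRs⟩ :=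
    exists_radial_solution hHa
      (h := fun r θ => (Real.cos θ * p r θ + Real.sin θ * q r θ)
        / (Real.cos θ * q r θ - n * Real.sin θ * p r θ)) (by
      filter_upwards [hHB] with u hu θ
      obtain ⟨h1, h2, h3⟩ := hu θ
      rw [← h1, ← h3, mul_div_cancel_right₀ _ h2.ne'])
  let o : Icc (0 : ℝ) Real.pi := ⟨Real.pi, Real.pi_nonneg, le_rfl⟩
  let u : ℝ → C(Icc (0 : ℝ) Real.pi, ℝ) := fun x => x • NormedSpace.exp (v x)
  have hu : ∀ x θ, u x θ = x * Real.exp (v x θ) := fun x θ => by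
    simp [u, ContinuousMap.exp_apply]
  have hwa : AnalyticAt ℝ (fun x => NormedSpace.exp (v x)) 0 :=
    AnalyticAt.fun_comp (NormedSpace.exp_analytic _) hva
  have hua : AnalyticAt ℝ u 0 := analyticAt_id.smul hwa
  have hu0 : u 0 = 0 := zero_smul _ _
  have hut : Tendsto u (𝓝 0) (𝓝 0) := by simpa [hu0] using hua.continuousAt.tendsto
  let D : C(Icc (0 : ℝ) Real.pi, ℝ) :=
    ⟨fun θ => Real.cos θ ^ 2 + n * Real.sin θ ^ 2, by fun_prop⟩
  have hD : ∀ θ, 0 < D θ := fun θ => by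
    have h1 : (2 : ℝ) ≤ n := by exact_mod_cast hn
    have h2 := Real.sin_sq_add_cos_sq (θ : ℝ)
    simp only [D, ContinuousMap.coe_mk]
    nlinarith [sq_nonneg (Real.sin θ)]
  -- As `r = x exp v`, one has `r ^ (n - 1) B = x ^ (n - 1) M`. Hence `dt/dθ = x ^ (1 - n) κ` with
  -- `κ = D / M` analytic in `x` up to `0`.
  let M : ℝ → C(Icc (0 : ℝ) Real.pi, ℝ) := fun x => NormedSpace.exp (v x) ^ (n - 1) * B (u x)
  have hMa : AnalyticAt ℝ M 0 :=
    (hwa.pow (n - 1)).mul (AnalyticAt.fun_comp (by rwa [hu0]) hua)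
  have hM : ∀ x θ, M x θ = Real.exp (v x θ) ^ (n - 1) * B (u x) θ := fun x θ => by
    simp [M, ContinuousMap.exp_apply]
  have hunit {x : ℝ} (hx : ∀ θ, 0 < B (u x) θ) : IsUnit (M x) :=
    ContinuousMap.isUnit_iff_forall_ne_zero _ |>.2 fun θ => by
      rw [hM]; exact (mul_pos (pow_pos (Real.exp_pos _) _) (hx θ)).ne'
  let κ : ℝ → C(Icc (0 : ℝ) Real.pi, ℝ) := fun x => D * Ring.inverse (M x)
  have hκM {x : ℝ} (hx : ∀ θ, 0 < B (u x) θ) (θ) : κ x θ * M x θ = D θ := by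
    rw [← ContinuousMap.mul_apply, mul_assoc, Ring.inverse_mul_cancel _ (hunit hx), mul_one]
  have hκpos {x : ℝ} (hx : ∀ θ, 0 < B (u x) θ) (θ) : 0 < κ x θ := by
    refine pos_of_mul_pos_left (b := M x θ) ?_ ?_
    · rw [hκM hx]; exact hD θ
    · rw [hM]; exact (mul_pos (pow_pos (Real.exp_pos _) _) (hx θ)).le
  have hB0 : ∀ θ, 0 < B (u 0) θ := fun θ => by
    rw [hu0]; exact (hHB.self_of_nhds θ).2.1
  have hκa : AnalyticAt ℝ κ 0 := by
    obtain ⟨z, hz⟩ := hunit hB0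
    refine analyticAt_const.mul (AnalyticAt.fun_comp ?_ hMa)
    rw [← hz]
    exact analyticAt_inverse z
  have hΘa : AnalyticAt ℝ (fun x => volterra (κ x) o) 0 :=
    AnalyticAt.fun_comp
      (((ContinuousMap.evalCLM ℝ o : C(Icc (0 : ℝ) Real.pi, ℝ) →L[ℝ] ℝ).comp volterra).analyticAt _)
      hκa
  obtain ⟨T, hT⟩ := hΘa.exists_hasSum_pow_smul
  have hT0 : T 0 = volterra (κ 0) o := by
    refine HasSum.unique ?_ hT.self_of_nhds
    convert! hasSum_single (f := fun i => (0 : ℝ) ^ i • T i) 0 (fun i hi => by simp [hi]) using 1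
    simp
  have hφa : AnalyticAt ℝ (fun x => -(x * Real.exp (v x o))) 0 := by
    have h1 : AnalyticAt ℝ (fun x => -(u x o)) 0 :=
      (AnalyticAt.fun_comp ((ContinuousMap.evalCLM ℝ o : C(Icc (0 : ℝ) Real.pi, ℝ) →L[ℝ] ℝ).analyticAt
        _) hua).neg
    simpa only [hu] using h1
  have hev : ∀ᶠ x in 𝓝 (0 : ℝ),
      AnalyticAt ℝ (fun x => -(x * Real.exp (v x o))) x ∧
      HasSum (fun i => x ^ i • T i) (volterra (κ x) o) ∧
      HasSum (fun i : ℕ => R (i + 1) o * x ^ (i + 1)) (x * Real.exp (v x o)) ∧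
      (0 < x → ∀ t z, IsHalfReturn U P Q x t z ↔
        t = (x ^ (n - 1))⁻¹ * volterra (κ x) o ∧ z = -(x * Real.exp (v x o))) := by
    have hUev := eventually_forall_polar (by omega : n ≠ 0) (hU.mem_nhds h0)
    filter_upwards [hφa.eventually_analyticAt, hT, hRs, hv, hut.eventually hHB,
      hut.eventually (ContinuousMap.eventually_forall_apply (hpq.and hUev))]
      with x h1 h2 h3 h4 h5 h6
    refine ⟨h1, h2, h3 o, fun hx => ?_⟩
    have h7 : ∀ θ, x * Real.exp (volterra (H (u x)) θ) = u x θ := fun θ => by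
      rw [hu]; congr 3; exact h4.symm
    have hret : IsHalfReturn U P Q x ((x ^ (n - 1))⁻¹ * volterra (κ x) o)
        (-(x * Real.exp (v x o))) := by
      have := isHalfReturn_of_polar (U := U) (P := P) (Q := Q) (n := n) (by omega) hx
        (h := H (u x)) (b := B (u x)) (k := (x ^ (n - 1))⁻¹ • κ x)
        (p := fun θ => p (IccExtend Real.pi_nonneg (u x) θ) θ)
        (q := fun θ => q (IccExtend Real.pi_nonneg (u x) θ) θ)
        (fun θ => (h5 θ).2.1)
        (fun θ => mul_pos (by positivity) (hκpos (fun θ => (h5 θ).2.1) θ))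
        (fun θ => by rw [IccExtend_val]; exact (h5 θ).1)
        (fun θ => by rw [IccExtend_val]; exact (h5 θ).2.2)
        (fun θ => by
          have := hκM (fun θ => (h5 θ).2.1) θ
          rw [hM] at this
          rw [h7, hu, mul_pow, ContinuousMap.smul_apply, smul_eq_mul]
          have hx' : x ^ (n - 1) ≠ 0 := by positivity
          rw [show Real.cos (θ : ℝ) ^ 2 + n * Real.sin (θ : ℝ) ^ 2 = D θ from rfl, ← this]
          field_simp)
        (fun θ => by rw [h7]; exact (h6 θ).2 θ)
        (fun θ => by rw [h7, IccExtend_val]; exact ((h6 θ).1 θ).1)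
        (fun θ => by rw [h7, IccExtend_val]; exact ((h6 θ).1 θ).2)
      rwa [h7, hu, map_smul, ContinuousMap.smul_apply, smul_eq_mul] at this
    refine fun t z => ⟨fun h => ?_, fun h => by rw [h.1, h.2]; exact hret⟩
    refine h.unique hP hQ hret ?_
    -- At `θ = 0` the angular factor `B` equals `q`, so `Q (x, 0) = x ^ (2n - 1) q` is positive.
    let o' : Icc (0 : ℝ) Real.pi := ⟨0, le_rfl, Real.pi_nonneg⟩
    have h8 : u x o' = x := by
      rw [← h7, volterra_apply]; simp [o']
    have h9 := ((h6 o').1 0).2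
    have h10 := (h5 o').2.1
    rw [(h5 o').1] at h10
    simp only [o', Real.cos_zero, Real.sin_zero, mul_zero, zero_mul, sub_zero, one_mul,
      mul_one] at h8 h9 h10
    rw [h8] at h9 h10
    rw [h9]
    positivity
  obtain ⟨x₀, hx₀, hball⟩ := Metric.eventually_nhds_iff.1 hev
  have hmem {x : ℝ} (hx : x ∈ Ico 0 x₀) : dist x 0 < x₀ := by
    rw [Real.dist_0_eq_abs, abs_of_nonneg hx.1]; exact hx.2
  refine ⟨x₀, fun x => -(x * Real.exp (v x o)), fun x => (x ^ (n - 1))⁻¹ * volterra (κ x) o,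
    fun i => R i Real.pi, T, hx₀, fun x hx => ?_, fun x hx => ?_, by simp, fun x hx => ?_,
    fun x hx => ?_, ⟨C, R, fun θ hθ => ?_, hR0, hR1, hR2, hRd, fun _ _ => rfl⟩, ?_, ?_,
    fun x hx => ?_⟩
  · exact (hball (hmem (Ioo_subset_Ico_self hx))).2.2.2 hx.1
  · exact neg_neg_of_pos (mul_pos hx.1 (Real.exp_pos _))
  · exact (hball (hmem hx)).1
  · exact (hball (hmem hx)).2.2.1.neg
  · have h1t : Tendsto (fun r : ℝ => r • (1 : C(Icc (0 : ℝ) Real.pi, ℝ))) (𝓝 0) (𝓝 0) := by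
      have : Continuous fun r : ℝ => r • (1 : C(Icc (0 : ℝ) Real.pi, ℝ)) := by fun_prop
      simpa using this.tendsto 0
    filter_upwards [nhdsWithin_le_nhds (hC θ hθ), nhdsWithin_le_nhds hpq,
      nhdsWithin_le_nhds (h1t.eventually hHB), self_mem_nhdsWithin] with r hr1 hr2 hr3 hr
    obtain ⟨h1, h2, -⟩ := hr3 ⟨θ, hθ⟩
    rw [h1] at h2
    simp only [ContinuousMap.smul_apply, ContinuousMap.one_apply, smul_eq_mul, mul_one] at h2
    rwa [blowupR_div_blowupTheta (by omega) hr (hr2 θ).1 (hr2 θ).2 h2.ne']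
  · refine (hR1v o).trans ?_
    rw [hv0, volterra_apply]
    congr 1
    -- The integrand is `H 0`, the ratio of the polar components on the blown-up origin, where `p`
    -- and `q` are explicit.
    refine intervalIntegral.integral_congr fun θ hθ => ?_
    rw [uIcc_of_le Real.pi_nonneg] at hθ
    obtain ⟨h1, h2, h3⟩ := hHB.self_of_nhds ⟨θ, hθ⟩
    simp only [ContinuousMap.zero_apply] at h1 h3
    rw [(hpq0 θ).1, (hpq0 θ).2] at h1 h3
    rw [IccExtend_of_mem _ _ hθ, eq_div_iff_mul_eq]
    · obtain ⟨m, rfl⟩ : ∃ m, n = m + 1 := ⟨n - 1, by omega⟩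
      simp only [show 2 * (m + 1) - 1 = 2 * m + 1 by omega, Nat.add_sub_cancel] at h1 h3 ⊢
      have h4 : a * Real.cos θ ^ (2 * (m + 1)) + ((m + 1 : ℕ) : ℝ) * Real.sin θ ^ 2
          + ν * Real.cos θ ^ (m + 1) * Real.sin θ = B 0 ⟨θ, hθ⟩ := by
        rw [h1]; ring
      rw [h4, h3]; ring
    · obtain ⟨m, rfl⟩ : ∃ m, n = m + 1 := ⟨n - 1, by omega⟩
      simp only [show 2 * (m + 1) - 1 = 2 * m + 1 by omega, Nat.add_sub_cancel] at h1
      have h4 : a * Real.cos θ ^ (2 * (m + 1)) + ((m + 1 : ℕ) : ℝ) * Real.sin θ ^ 2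
          + ν * Real.cos θ ^ (m + 1) * Real.sin θ = B 0 ⟨θ, hθ⟩ := by
        rw [h1]; ring
      rw [h4]
      exact h2.ne'
  · rw [hT0]; exact volterra_pos (hκpos hB0)
  · have h1 := (hball (hmem (Ioo_subset_Ico_self hx))).2.1.mul_left (x ^ (n - 1))⁻¹
    refine h1.congr_fun fun i => ?_
    have hx0 : x ≠ 0 := hx.1.ne'
    rw [show (i : ℤ) + 1 - n = i - ((n - 1 : ℕ) : ℤ) by push_cast [show 1 ≤ n by omega]; ring,
      zpow_sub₀ hx0, zpow_natCast, zpow_natCast, smul_eq_mul]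
    field_simp
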